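/- Let $E \subset \mathbb{R}^n$ be a bounded set. For a bounded set $F$ and $r>0$ let $N(F,r)$ be the minimal number of sets of diameter at most $r$ needed to cover $F$. For $0<\theta<1$ let the (upper) $\theta$-intermediate dimension $\dim_\theta E$ be the infimum of those $s>0$ for which there are $C,\delta_0>0$ such that for every $\delta\in(0,\delta_0)$ the set $E$ can be covered by sets $A_i \subset \mathbb{R}^n$ with $\delta^{1/\theta}\le\operatorname{diam}A_i\le\delta$ for all $i$ and $\sum_i(\operatorname{diam}A_i)^s\le C$; let $\dim_{qH}E=\lim_{\theta\searrow0}\dim_\theta E$ be the quasi-Hausdorff dimension. Let the $\theta$-Assouad spectrum $\dim_A^\theta E$ be the infimum of those $s>0$ for which there is $C>0$ with $N(B(x,R)\cap E,r)\le C(R/r)^s$ whenever $x\in E$ and $0<r\le R^{1/\theta}<R<1$. The (upper) box-counting dimension $\dim_B Y$ of a metric space $Y$ is the infimum of those $s>0$ for which there is $C>0$ with $N(Y,r)\le Cr^{-s}$ for all $0<r<\operatorname{diam}Y$. A homeomorphism $f:X\to Y$ of metric spaces $(X,d)$, $(Y,d')$ is quasisymmetric if there is an increasing homeomorphism $\eta:[0,\infty)\to[0,\infty)$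 such that $d'(f(x),f(y))\le\eta(t)\,d'(f(x),f(z))$ whenever $x,y,z \in X$, $t>0$ and $d(x,y)\le t\,d(x,z)$. A homeomorphism $f:\mathbb{R}^n\to\mathbb{R}^n$ is quasiconformal if $$\sup_{x}\ \limsup_{r\to0}\frac{\sup_{|y-x|=r}|f(y)-f(x)|}{\inf_{|y-x|=r}|f(y)-f(x)|}<\infty ,$$ and, when $n=1$, $f$ is moreover quasisymmetric. The conformal box-counting dimension $C\dim_B E$ is the infimum of $\dim_B Y$ over all metric spaces $Y$ that are images of $E$ under a quasisymmetric homeomorphism. Theorem (Fraser--Tyson). If $E\subset\mathbb{R}^n$ is bounded and $\dim_{qH}E<1$, then for each $0<\theta<1$ $$\inf\{\dim_A^\theta f(E)\ :\ f:\mathbb{R}^n\to\mathbb{R}^n\text{ quasiconformal}\}=0 ,$$ and in particular $C\dim_B E=0$. -/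

import Mathlib

open Set Filter Topology
open scoped NNReal ENNReal

noncomputable section

/-! ### Covering numbers and dimensions

All dimensions take values in `ℝ≥0∞`, so that the infimum of an empty set of exponents is `∞`. -/

/-- `N(F, r)`: the minimal number of sets of diameter at most `r` needed to cover `F`
(equal to `∞` when no finite cover exists). -/
def diamCoveringNumber {X : Type*} [MetricSpace X] (F : Set X) (r : ℝ) : ℕ∞ :=
  ⨅ (𝒰 : Set (Set X)) (_ : F ⊆ ⋃₀ 𝒰 ∧ ∀ A ∈ 𝒰, Metric.ediam A ≤ ENNReal.ofReal r), 𝒰.encard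

/-- The (upper) box-counting dimension of a set: the infimum of those `s > 0` for which there is
`C > 0` with `N(E, r) ≤ C r⁻ˢ` for all `0 < r < diam E`. -/
def boxDim {X : Type*} [MetricSpace X] (E : Set X) : ℝ≥0∞ :=
  ⨅ (s : ℝ≥0) (_ : 0 < s ∧ ∃ C : ℝ, 0 < C ∧ ∀ r : ℝ, 0 < r → ENNReal.ofReal r < Metric.ediam E →
      (diamCoveringNumber E r : ℝ≥0∞) ≤ ENNReal.ofReal (C * r ^ (-(s : ℝ)))), (s : ℝ≥0∞)

/-- The `θ`-Assouad spectrum (in its upper, or regularized, form): the infimum of those `s > 0` for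
which there is `C > 0` with `N(B(x, R) ∩ E, r) ≤ C (R / r)ˢ` whenever `x ∈ E` and
`0 < r ≤ R ^ (1 / θ) < R < 1`. -/
def assouadSpectrum {X : Type*} [MetricSpace X] (θ : ℝ) (E : Set X) : ℝ≥0∞ :=
  ⨅ (s : ℝ≥0) (_ : 0 < s ∧ ∃ C : ℝ, 0 < C ∧ ∀ x ∈ E, ∀ r R : ℝ,
      0 < r → 0 < R → r ≤ R ^ (1 / θ) → R ^ (1 / θ) < R → R < 1 →
      (diamCoveringNumber (Metric.ball x R ∩ E) r : ℝ≥0∞) ≤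
        ENNReal.ofReal (C * (R / r) ^ (s : ℝ))), (s : ℝ≥0∞)

/-- The (upper) `θ`-intermediate dimension: the infimum of those `s > 0` for which there are
`C, δ₀ > 0` such that for every `δ ∈ (0, δ₀)` the set `E` has a cover by sets `A` with
`δ ^ (1 / θ) ≤ diam A ≤ δ` and `∑ (diam A)ˢ ≤ C`. -/
def intermediateDim {X : Type*} [MetricSpace X] (θ : ℝ) (E : Set X) : ℝ≥0∞ :=
  ⨅ (s : ℝ≥0) (_ : 0 < s ∧ ∃ C : ℝ, 0 < C ∧ ∃ δ₀ : ℝ, 0 < δ₀ ∧ ∀ δ : ℝ, 0 < δ → δ < δ₀ →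
      ∃ 𝒰 : Set (Set X), E ⊆ ⋃₀ 𝒰 ∧
        (∀ A ∈ 𝒰, ENNReal.ofReal (δ ^ (1 / θ)) ≤ Metric.ediam A ∧
          Metric.ediam A ≤ ENNReal.ofReal δ) ∧
        ∑' A : 𝒰, Metric.ediam (A : Set X) ^ (s : ℝ) ≤ ENNReal.ofReal C), (s : ℝ≥0∞)

/-- The quasi-Hausdorff dimension, the limit of the `θ`-intermediate dimensions as `θ ↘ 0`. The
limit exists, see `tendsto_intermediateDim`. -/
def quasiHausdorffDim {X : Type*} [MetricSpace X] (E : Set X) : ℝ≥0∞ :=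
  limUnder (𝓝[>] (0 : ℝ)) (fun θ : ℝ => intermediateDim θ E)

theorem intermediateDim_mono {X : Type*} [MetricSpace X] (E : Set X) {θ θ' : ℝ}
    (hθ : 0 < θ) (h : θ ≤ θ') : intermediateDim θ E ≤ intermediateDim θ' E := by
  refine le_iInf₂ fun s hs => ?_
  obtain ⟨hs0, C, hC, δ₀, hδ₀, H⟩ := hs
  refine iInf₂_le s ⟨hs0, C, hC, min δ₀ 1, lt_min hδ₀ one_pos, fun δ hδ hδ' => ?_⟩
  obtain ⟨𝒰, hcov, hdiam, hsum⟩ := H δ hδ (hδ'.trans_le (min_le_left _ _))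
  refine ⟨𝒰, hcov, fun A hA => ⟨le_trans (ENNReal.ofReal_le_ofReal ?_) (hdiam A hA).1,
    (hdiam A hA).2⟩, hsum⟩
  exact Real.rpow_le_rpow_of_exponent_ge hδ (hδ'.trans_le (min_le_right _ _)).le
    (one_div_le_one_div_of_le hθ h)

theorem tendsto_intermediateDim {X : Type*} [MetricSpace X] (E : Set X) :
    Tendsto (fun θ : ℝ => intermediateDim θ E) (𝓝[>] 0) (𝓝 (quasiHausdorffDim E)) := by
  refine tendsto_nhds_limUnder ⟨sInf ((fun θ : ℝ => intermediateDim θ E) '' Ioi 0), ?_⟩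
  exact MonotoneOn.tendsto_nhdsGT (fun a ha b _ hab => intermediateDim_mono E ha hab)
    (OrderBot.bddBelow _)

/-! ### Quasisymmetric and quasiconformal homeomorphisms -/

/-- A homeomorphism of metric spaces is quasisymmetric if it is `η`-quasisymmetric for some
increasing homeomorphism `η` of `[0, ∞)` (an order isomorphism of `ℝ≥0`). -/
def IsQuasisymmetric {X Y : Type*} [MetricSpace X] [MetricSpace Y] (f : X ≃ₜ Y) : Prop :=
  ∃ η : ℝ≥0 ≃o ℝ≥0, ∀ (x y z : X) (t : ℝ≥0), 0 < t → nndist x y ≤ t * nndist x z →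
    nndist (f x) (f y) ≤ η t * nndist (f x) (f z)

/-- The metric dilatation `H_f(x) = limsup_{r → 0} L_f(x, r) / ℓ_f(x, r)`, where
`L_f(x, r) = sup_{|y - x| = r} |f y - f x|` and `ℓ_f(x, r) = inf_{|y - x| = r} |f y - f x|`. -/
def metricDilatation {X Y : Type*} [MetricSpace X] [MetricSpace Y] (f : X → Y) (x : X) : ℝ≥0∞ :=
  limsup (fun r : ℝ => (⨆ y ∈ Metric.sphere x r, edist (f x) (f y)) /
    (⨅ y ∈ Metric.sphere x r, edist (f x) (f y))) (𝓝[>] 0)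

/-- A homeomorphism of `ℝⁿ` is quasiconformal if its metric dilatation is uniformly bounded. On
the line the bound on the metric dilatation is not enough, and there quasiconformal means
quasisymmetric, as usual. -/
def IsQuasiconformal {n : ℕ} (f : EuclideanSpace ℝ (Fin n) ≃ₜ EuclideanSpace ℝ (Fin n)) : Prop :=
  (∃ H : ℝ≥0, ∀ x, metricDilatation f x ≤ H) ∧ (n = 1 → IsQuasisymmetric f)

/-- The conformal box-counting dimension of a metric space `X`: the infimum of `dim_B Y` over all
metric spaces `Y` quasisymmetrically equivalent to `X`. (Such a `Y` is in bijection with `X`, so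
nothing is lost by taking it in the universe of `X`.) -/
def conformalBoxDim (X : Type) [MetricSpace X] : ℝ≥0∞ :=
  ⨅ (Y : Type) (_ : MetricSpace Y) (f : X ≃ₜ Y) (_ : IsQuasisymmetric f), boxDim (univ : Set Y)

end

open MeasureTheory

/-! ### Negative powers of linear functions -/

/-! Since `quasiHausdorffDim E < 1`, some `θ > 0` and `s < 1` give, at every scale `D k = δ 2⁻ᵏ`, a
cover `𝒰 k` of `E` by sets of diameter between `D k ^ (1 / θ)` and `D k` with `∑ diamˢ ≤ C`, hence
with at most `C (D k) ^ (-s / θ)` members. This count is polynomial in `1 / D k`, so an image of `E`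
has small box dimension as soon as a quasisymmetric map shrinks every member of `𝒰 k` to size about
`(D k) ^ M` with `M` large.

Such a map comes from a measure. Fix `s < t < β < 1` and put mass `(diam A)ᵗ` at a point of each `A`
(`exists_measure_ediam_rpow_le`); the total mass is finite because `t > s`. On `A`, at scale `diam
A`, the Riesz potential of order `β` is at least of order `(diam A) ^ (t - β)`
(`conformalFactor_le_of_le_measure`). By `exists_isQuasisymmetric_norm_sub_le` some quasisymmetric
`f` satisfies `‖f y - f x‖ ≲ r Φ(x, r)` with `r = ‖y - x‖`, where `Φ` is the power `-N` of the
potential smoothed at scale `r`. A large `N` makes `M = (β - t) N` large.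

The map is `monotoneMap`, a superposition over directions `v` of one-dimensional maps whose
derivative is the power `-N` of a slab potential. Projections shorten distances, so this derivative
is at most `Φ`, which bounds `f` from above. Conversely, averaged over `v` and over a segment, the
slab potential is at most a constant times the Riesz potential, since `|t| ^ (-β)` is locally
integrable for `β < 1`; this is where dimension less than `1` is needed. Markov's inequality turns
the average into a lower bound for the derivative on most of the directions and of the segment
(`exists_le_inner_monotoneMap_sub`). The two bounds, with `Φ` increasing and of polynomial growth in
`r`, make `f` quasisymmetric. -/

theorem exists_lintegral_Ioc_abs_add_rpow_le {β : ℝ} (hβ0 : 0 < β) (hβ1 : β < 1) :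
    ∃ D : ℝ≥0, 1 ≤ D ∧ ∀ c : ℝ,
      ∫⁻ τ in Ioc (0 : ℝ) 1, ENNReal.ofReal |c + τ| ^ (-β) ≤ D := by
  have hpos : ∫⁻ s in Ioc (0 : ℝ) 1, ENNReal.ofReal |s| ^ (-β) < ⊤ := by
    have h1 : IntegrableOn (fun s : ℝ => s ^ (-β)) (Ioc 0 1) := by
      rw [← intervalIntegrable_iff_integrableOn_Ioc_of_le zero_le_one]
      exact intervalIntegral.intervalIntegrable_rpow' (by linarith)
    refine lt_of_eq_of_lt ?_ h1.lintegral_lt_top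
    refine setLIntegral_congr_fun measurableSet_Ioc fun s hs => ?_
    rw [abs_of_pos hs.1, ENNReal.ofReal_rpow_of_pos hs.1]
  have hneg : ∫⁻ s in Ico (-1 : ℝ) 0, ENNReal.ofReal |s| ^ (-β) < ⊤ := by
    refine lt_of_eq_of_lt ?_ hpos
    have hm := (Measure.measurePreserving_neg (volume : Measure ℝ)).setLIntegral_comp_preimage
      (s := Ioc 0 1) (f := fun s : ℝ => ENNReal.ofReal |s| ^ (-β)) measurableSet_Ioc (by fun_prop)
    rw [← hm]
    simp
  set D₁ := ∫⁻ s in Ico (-1 : ℝ) 0, ENNReal.ofReal |s| ^ (-β)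
  set D₂ := ∫⁻ s in Ioc (0 : ℝ) 1, ENNReal.ofReal |s| ^ (-β)
  have hD : 1 + (D₁ + D₂) ≠ ⊤ := by
    simp only [ne_eq, ENNReal.add_eq_top, ENNReal.one_ne_top, hneg.ne, hpos.ne, or_self,
      not_false_iff]
  refine ⟨(1 + (D₁ + D₂)).toNNReal, ?_, fun c => ?_⟩
  · rw [← ENNReal.coe_le_coe, ENNReal.coe_toNNReal hD]
    simp
  rw [ENNReal.coe_toNNReal hD]
  -- The left side is `∞` at `s = 0`, so one of the two intervals has to contain `0`; a null set
  -- does not change the integrals.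
  have hsplit : ∀ s : ℝ, ENNReal.ofReal |s| ^ (-β) ≤
      1 + ((Ico (-1 : ℝ) 0).indicator (fun s => ENNReal.ofReal |s| ^ (-β)) s +
        (Icc (0 : ℝ) 1).indicator (fun s => ENNReal.ofReal |s| ^ (-β)) s) := by
    intro s
    by_cases h1 : s ∈ Ico (-1 : ℝ) 0
    · rw [indicator_of_mem h1]
      exact (self_le_add_right _ _).trans (self_le_add_left _ _)
    by_cases h2 : s ∈ Icc (0 : ℝ) 1
    · rw [indicator_of_mem h2]
      exact (self_le_add_left _ _).trans (self_le_add_left _ _)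
    refine le_trans ?_ (self_le_add_right _ _)
    refine ENNReal.rpow_le_one_of_one_le_of_neg ?_ (by linarith)
    rw [ENNReal.one_le_ofReal]
    simp only [mem_Ico, mem_Icc, not_and, not_lt, not_le] at h1 h2
    rcases le_total 0 s with h | h
    · exact (h2 h).le.trans (le_abs_self s)
    · by_contra! hlt
      rw [abs_of_nonpos h] at hlt
      have := h1 (by linarith)
      have h0 : s = 0 := le_antisymm h this
      have := h2 h0.ge
      linarith
  calc ∫⁻ τ in Ioc (0 : ℝ) 1, ENNReal.ofReal |c + τ| ^ (-β)
      ≤ ∫⁻ τ in Ioc (0 : ℝ) 1, (1 +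
        ((Ico (-1 : ℝ) 0).indicator (fun s => ENNReal.ofReal |s| ^ (-β)) (c + τ) +
        (Icc (0 : ℝ) 1).indicator (fun s => ENNReal.ofReal |s| ^ (-β)) (c + τ))) :=
        lintegral_mono fun τ => hsplit (c + τ)
    _ = 1 + ∫⁻ τ in Ioc (0 : ℝ) 1,
        ((Ico (-1 : ℝ) 0).indicator (fun s => ENNReal.ofReal |s| ^ (-β)) (c + τ) +
        (Icc (0 : ℝ) 1).indicator (fun s => ENNReal.ofReal |s| ^ (-β)) (c + τ)) := by
        rw [lintegral_add_left measurable_const]; simp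
    _ ≤ 1 + ∫⁻ τ : ℝ, ((Ico (-1 : ℝ) 0).indicator (fun s => ENNReal.ofReal |s| ^ (-β)) (c + τ) +
        (Icc (0 : ℝ) 1).indicator (fun s => ENNReal.ofReal |s| ^ (-β)) (c + τ)) := by
        gcongr; exact Measure.restrict_le_self
    _ = 1 + (D₁ + D₂) := by
        rw [lintegral_add_left' , lintegral_add_left_eq_self (fun τ =>
          (Ico (-1 : ℝ) 0).indicator (fun s => ENNReal.ofReal |s| ^ (-β)) τ),
          lintegral_add_left_eq_self (fun τ =>
          (Icc (0 : ℝ) 1).indicator (fun s => ENNReal.ofReal |s| ^ (-β)) τ),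
          lintegral_indicator measurableSet_Ico, lintegral_indicator measurableSet_Icc,
          setLIntegral_congr Ioc_ae_eq_Icc.symm]
        have : Measurable fun s : ℝ => ENNReal.ofReal |s| ^ (-β) := by fun_prop
        exact ((this.indicator measurableSet_Ico).comp (measurable_const_add c)).aemeasurable

theorem ENNReal.rpow_neg_le_rpow_neg {a b : ℝ≥0∞} (h : a ≤ b) {β : ℝ} (hβ : 0 ≤ β) :
    b ^ (-β) ≤ a ^ (-β) := by
  rw [ENNReal.rpow_neg, ENNReal.rpow_neg]
  exact ENNReal.inv_le_inv.2 (ENNReal.rpow_le_rpow h hβ)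

section InnerProductSpace

variable {H : Type*} [NormedAddCommGroup H] [InnerProductSpace ℝ H]

/-- If `‖p‖ ≥ 2‖q‖`, the segment stays at distance comparable to `‖q‖ + ‖p‖` from the origin.
Otherwise `‖q‖` is comparable to that sum, and projecting to the line of `q` leaves the
one-dimensional integral. -/
theorem exists_lintegral_Ioc_norm_add_smul_rpow_le {β : ℝ} (hβ0 : 0 < β) (hβ1 : β < 1) :
    ∃ C : ℝ≥0, ∀ p q : H, q ≠ 0 →
      ∫⁻ τ in Ioc (0 : ℝ) 1, ENNReal.ofReal ‖p + τ • q‖ ^ (-β) ≤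
        C * ENNReal.ofReal (‖q‖ + ‖p‖) ^ (-β) := by
  obtain ⟨D, hD1, hD⟩ := exists_lintegral_Ioc_abs_add_rpow_le hβ0 hβ1
  refine ⟨3 ^ β * D, fun p q hq => ?_⟩
  have hq' : 0 < ‖q‖ := norm_pos_iff.2 hq
  have h3 : ∀ a : ℝ, 0 < a → ‖q‖ + ‖p‖ ≤ 3 * a →
      ENNReal.ofReal a ^ (-β) ≤ (3 : ℝ≥0∞) ^ β * ENNReal.ofReal (‖q‖ + ‖p‖) ^ (-β) := by
    intro a ha h
    calc ENNReal.ofReal a ^ (-β) = 3 ^ β * ENNReal.ofReal (3 * a) ^ (-β) := by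
          rw [ENNReal.ofReal_mul (by norm_num), ENNReal.mul_rpow_of_ne_top (by simp) (by simp),
            ← mul_assoc, ENNReal.ofReal_ofNat, ← ENNReal.rpow_add _ _ (by simp) (by simp)]
          simp
      _ ≤ _ := by
          exact mul_le_mul_right
            (ENNReal.rpow_neg_le_rpow_neg (ENNReal.ofReal_le_ofReal h) hβ0.le) _
  have hcoe : ((3 ^ β * D : ℝ≥0) : ℝ≥0∞) = 3 ^ β * D := by
    rw [ENNReal.coe_mul, ENNReal.coe_rpow_of_nonneg _ hβ0.le]; simp
  rw [hcoe]
  rcases le_total (2 * ‖q‖) ‖p‖ with h | h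
  · calc ∫⁻ τ in Ioc (0 : ℝ) 1, ENNReal.ofReal ‖p + τ • q‖ ^ (-β)
        ≤ ∫⁻ τ in Ioc (0 : ℝ) 1, 3 ^ β * ENNReal.ofReal (‖q‖ + ‖p‖) ^ (-β) := by
          refine setLIntegral_mono measurable_const fun τ hτ => ?_
          have h1 : ‖p‖ - ‖q‖ ≤ ‖p + τ • q‖ := by
            have h2 : ‖τ • q‖ ≤ ‖q‖ := by
              rw [norm_smul, Real.norm_of_nonneg hτ.1.le]
              exact mul_le_of_le_one_left hq'.le hτ.2
            have h4 := norm_sub_le (p + τ • q) (τ • q)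
            rw [add_sub_cancel_right] at h4
            linarith
          exact h3 _ (by linarith) (by linarith)
      _ = 3 ^ β * 1 * ENNReal.ofReal (‖q‖ + ‖p‖) ^ (-β) := by simp
      _ ≤ _ := by gcongr; exact_mod_cast hD1
  · set c : ℝ := inner ℝ p q / ‖q‖ ^ 2
    calc ∫⁻ τ in Ioc (0 : ℝ) 1, ENNReal.ofReal ‖p + τ • q‖ ^ (-β)
        ≤ ∫⁻ τ in Ioc (0 : ℝ) 1, ENNReal.ofReal ‖q‖ ^ (-β) * ENNReal.ofReal |c + τ| ^ (-β) := by
          refine lintegral_mono fun τ => ?_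
          rw [← ENNReal.mul_rpow_of_ne_top (by simp) (by simp),
            ← ENNReal.ofReal_mul (norm_nonneg _)]
          refine ENNReal.rpow_neg_le_rpow_neg (ENNReal.ofReal_le_ofReal ?_) hβ0.le
          have h1 : inner ℝ (p + τ • q) q = ‖q‖ ^ 2 * (c + τ) := by
            rw [inner_add_left, inner_smul_left, real_inner_self_eq_norm_sq]
            simp only [c, conj_trivial]
            field_simp
          have h2 := abs_real_inner_le_norm (p + τ • q) q
          rw [h1, abs_mul, abs_of_pos (by positivity), sq] at h2
          nlinarith
      _ = ENNReal.ofReal ‖q‖ ^ (-β) * ∫⁻ τ in Ioc (0 : ℝ) 1, ENNReal.ofReal |c + τ| ^ (-β) := by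
          rw [lintegral_const_mul]; fun_prop
      _ ≤ (3 ^ β * ENNReal.ofReal (‖q‖ + ‖p‖) ^ (-β)) * D := by
          gcongr
          · exact h3 _ hq' (by linarith)
          · exact hD c
      _ = _ := by ring

variable [FiniteDimensional ℝ H] [MeasurableSpace H] [BorelSpace H]

/-- Translation by `τ • e`, for `e` the direction of `p`, moves `⟪e, v⟫` by `τ` and keeps the unit
ball inside the ball of radius `2`. Averaging over `τ ∈ (0, 1]` and exchanging the integrals reduces
to the line. -/
theorem exists_lintegral_ball_abs_inner_rpow_le {β : ℝ} (hβ0 : 0 < β) (hβ1 : β < 1) :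
    ∃ C : ℝ≥0, ∀ p : H, ∫⁻ v in Metric.closedBall (0 : H) 1,
      ENNReal.ofReal |inner ℝ p v| ^ (-β) ≤ C * ENNReal.ofReal ‖p‖ ^ (-β) := by
  obtain ⟨D, hD1, hD⟩ := exists_lintegral_Ioc_abs_add_rpow_le hβ0 hβ1
  have hfin : volume (Metric.closedBall (0 : H) 2) ≠ ⊤ := measure_closedBall_lt_top.ne
  -- The summand `1` makes the constant visibly nonzero, so that the right side is `∞` when `p = 0`.
  refine ⟨(volume (Metric.closedBall (0 : H) 2)).toNNReal * D + 1, fun p => ?_⟩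
  rw [ENNReal.coe_add, ENNReal.coe_mul, ENNReal.coe_toNNReal hfin]
  rcases eq_or_ne p 0 with rfl | hp
  · simp [hβ0, ENNReal.mul_top]
  have hp' : 0 < ‖p‖ := norm_pos_iff.2 hp
  set e : H := ‖p‖⁻¹ • p
  have he : ‖e‖ = 1 := by simp [e, norm_smul, hp'.ne']
  have hpe : ∀ v : H, inner ℝ p v = ‖p‖ * inner ℝ e v := by
    intro v; simp [e, inner_smul_left]; field_simp
  set h : ℝ → ℝ≥0∞ := fun t => ENNReal.ofReal |t| ^ (-β) with hh
  have hmeas : Measurable h := by fun_prop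
  have hshift : ∀ τ ∈ Ioc (0 : ℝ) 1, ∫⁻ v in Metric.closedBall (0 : H) 1, h (inner ℝ e v) ≤
      ∫⁻ v in Metric.closedBall (0 : H) 2, h (inner ℝ e v + τ) := by
    intro τ hτ
    rw [← lintegral_indicator measurableSet_closedBall,
      ← lintegral_indicator measurableSet_closedBall,
      ← lintegral_add_right_eq_self _ (τ • e)]
    refine lintegral_mono fun v => ?_
    by_cases hv : v + τ • e ∈ Metric.closedBall (0 : H) 1
    · have hv2 : v ∈ Metric.closedBall (0 : H) 2 := by
        rw [mem_closedBall_zero_iff] at hv ⊢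
        have h2 : ‖τ • e‖ ≤ 1 := by
          rw [norm_smul, he, Real.norm_of_nonneg hτ.1.le, mul_one]; exact hτ.2
        have h4 := norm_sub_le (v + τ • e) (τ • e)
        rw [add_sub_cancel_right] at h4
        linarith
      rw [indicator_of_mem hv, indicator_of_mem hv2, inner_add_right, inner_smul_right,
        real_inner_self_eq_norm_sq, he]
      simp
    · rw [indicator_of_notMem hv]; exact zero_le
  have hunit : ∫⁻ v in Metric.closedBall (0 : H) 1, h (inner ℝ e v) ≤
      volume (Metric.closedBall (0 : H) 2) * D := by
    calc ∫⁻ v in Metric.closedBall (0 : H) 1, h (inner ℝ e v)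
        = ∫⁻ _τ in Ioc (0 : ℝ) 1, ∫⁻ v in Metric.closedBall (0 : H) 1, h (inner ℝ e v) := by simp
      _ ≤ ∫⁻ τ in Ioc (0 : ℝ) 1, ∫⁻ v in Metric.closedBall (0 : H) 2, h (inner ℝ e v + τ) :=
          setLIntegral_mono' measurableSet_Ioc hshift
      _ = ∫⁻ v in Metric.closedBall (0 : H) 2, ∫⁻ τ in Ioc (0 : ℝ) 1, h (inner ℝ e v + τ) := by
          refine lintegral_lintegral_swap ?_
          exact (hmeas.comp (by fun_prop)).aemeasurable
      _ ≤ ∫⁻ v in Metric.closedBall (0 : H) 2, D := lintegral_mono fun v => hD _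
      _ = volume (Metric.closedBall (0 : H) 2) * D := by simp [mul_comm]
  calc ∫⁻ v in Metric.closedBall (0 : H) 1, ENNReal.ofReal |inner ℝ p v| ^ (-β)
      = ∫⁻ v in Metric.closedBall (0 : H) 1, ENNReal.ofReal ‖p‖ ^ (-β) * h (inner ℝ e v) := by
        refine lintegral_congr fun v => ?_
        rw [hpe, abs_mul, abs_norm, ENNReal.ofReal_mul (norm_nonneg _),
          ENNReal.mul_rpow_of_ne_top (by simp) (by simp)]
    _ = ENNReal.ofReal ‖p‖ ^ (-β) * ∫⁻ v in Metric.closedBall (0 : H) 1, h (inner ℝ e v) := by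
        rw [lintegral_const_mul]; exact hmeas.comp (by fun_prop)
    _ ≤ ENNReal.ofReal ‖p‖ ^ (-β) * (volume (Metric.closedBall (0 : H) 2) * D) := by gcongr
    _ = volume (Metric.closedBall (0 : H) 2) * D * ENNReal.ofReal ‖p‖ ^ (-β) := by ring
    _ ≤ _ := by gcongr; exact self_le_add_right _ _

/-- On the ball of radius `1 / 4` about `e / 2` one has `⟪e, v⟫ ≥ 1 / 4`, and its volume does not
depend on `e`. -/
theorem exists_le_lintegral_ball_inner_sq :
    ∃ m : ℝ, 0 < m ∧ ∀ e : H, ‖e‖ = 1 → ENNReal.ofReal m ≤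
      ∫⁻ v in Metric.closedBall (0 : H) 1, ENNReal.ofReal (inner ℝ e v ^ 2) := by
  have hfin : volume (Metric.ball (0 : H) (1 / 4)) ≠ ⊤ := measure_ball_lt_top.ne
  have hpos : 0 < volume (Metric.ball (0 : H) (1 / 4)) := Metric.measure_ball_pos _ _ (by norm_num)
  refine ⟨1 / 16 * (volume (Metric.ball (0 : H) (1 / 4))).toReal,
    mul_pos (by norm_num) (ENNReal.toReal_pos hpos.ne' hfin), fun e he => ?_⟩
  have hsub : Metric.ball ((1 / 2 : ℝ) • e) (1 / 4) ⊆ Metric.closedBall (0 : H) 1 := by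
    intro v hv
    rw [mem_ball_iff_norm] at hv
    rw [mem_closedBall_zero_iff]
    have h1 : ‖(1 / 2 : ℝ) • e‖ = 1 / 2 := by rw [norm_smul, he]; norm_num
    have h2 := norm_add_le (v - (1 / 2 : ℝ) • e) ((1 / 2 : ℝ) • e)
    rw [sub_add_cancel] at h2
    linarith
  calc ENNReal.ofReal (1 / 16 * (volume (Metric.ball (0 : H) (1 / 4))).toReal)
      = ENNReal.ofReal (1 / 16) * volume (Metric.ball ((1 / 2 : ℝ) • e) (1 / 4)) := by
        rw [ENNReal.ofReal_mul (by norm_num), ENNReal.ofReal_toReal hfin,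
          Measure.addHaar_ball_center _ ((1 / 2 : ℝ) • e)]
    _ = ∫⁻ v in Metric.ball ((1 / 2 : ℝ) • e) (1 / 4), ENNReal.ofReal (1 / 16) := by simp
    _ ≤ ∫⁻ v in Metric.ball ((1 / 2 : ℝ) • e) (1 / 4), ENNReal.ofReal (inner ℝ e v ^ 2) := by
        refine setLIntegral_mono' measurableSet_ball fun v hv => ENNReal.ofReal_le_ofReal ?_
        rw [mem_ball_iff_norm] at hv
        have h1 := abs_real_inner_le_norm e (v - (1 / 2 : ℝ) • e)
        rw [inner_sub_right, inner_smul_right, real_inner_self_eq_norm_sq, he, one_mul,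
          abs_le] at h1
        nlinarith [h1.1]
    _ ≤ _ := lintegral_mono_set hsub

end InnerProductSpace

/-! ### A monotone map with prescribed conformal factor -/

section RieszPotential

variable {H : Type*} [NormedAddCommGroup H] [MeasurableSpace H]

/-- The Riesz potential of order `β` of `ν`, smoothed at scale `r`. -/
noncomputable def rieszPotential (ν : Measure H) (β : ℝ) (x : H) (r : ℝ) : ℝ≥0∞ :=
  ∫⁻ y, ENNReal.ofReal (r + ‖x - y‖) ^ (-β) ∂ν

/-- The power `-N` of the smoothed Riesz potential. -/
noncomputable def conformalFactor (ν : Measure H) (β N : ℝ) (x : H) (r : ℝ) : ℝ :=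
  (rieszPotential ν β x r ^ (-N)).toReal

theorem rieszPotential_ne_top (ν : Measure H) [IsFiniteMeasure ν] {β : ℝ} (hβ : 0 < β) (x : H)
    {r : ℝ} (hr : 0 < r) : rieszPotential ν β x r ≠ ⊤ := by
  refine ne_top_of_le_ne_top (b := ENNReal.ofReal r ^ (-β) * ν univ) ?_ ?_
  · refine ENNReal.mul_ne_top ?_ (measure_ne_top _ _)
    rw [ENNReal.ofReal_rpow_of_pos hr]
    exact ENNReal.ofReal_ne_top
  · rw [← lintegral_const]
    refine lintegral_mono fun y => ENNReal.rpow_neg_le_rpow_neg (ENNReal.ofReal_le_ofReal ?_) hβ.le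
    linarith [norm_nonneg (x - y)]

theorem rieszPotential_anti (ν : Measure H) {β : ℝ} (hβ : 0 < β) (x : H) {r R : ℝ} (h : r ≤ R) :
    rieszPotential ν β x R ≤ rieszPotential ν β x r :=
  lintegral_mono fun y =>
    ENNReal.rpow_neg_le_rpow_neg (ENNReal.ofReal_le_ofReal (by linarith)) hβ.le

theorem rieszPotential_le_mul (ν : Measure H) {β : ℝ} (hβ : 0 < β) (x : H) {r t : ℝ}
    (ht : 1 ≤ t) :
    rieszPotential ν β x r ≤ ENNReal.ofReal t ^ β * rieszPotential ν β x (t * r) := by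
  have ht0 : 0 < t := by linarith
  have ht' : ENNReal.ofReal t ≠ 0 := by simpa using ht0
  rw [rieszPotential, rieszPotential, ← lintegral_const_mul' _ _
    (ENNReal.rpow_ne_top_of_nonneg hβ.le ENNReal.ofReal_ne_top)]
  refine lintegral_mono fun y => ?_
  calc ENNReal.ofReal (r + ‖x - y‖) ^ (-β)
      = ENNReal.ofReal t ^ β * ENNReal.ofReal (t * (r + ‖x - y‖)) ^ (-β) := by
        rw [ENNReal.ofReal_mul ht0.le, ENNReal.mul_rpow_of_ne_top (by simp) (by simp), ← mul_assoc,
          ← ENNReal.rpow_add _ _ ht' (by simp)]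
        simp
    _ ≤ _ := by
        refine mul_le_mul_right (ENNReal.rpow_neg_le_rpow_neg
          (ENNReal.ofReal_le_ofReal ?_) hβ.le) _
        nlinarith [norm_nonneg (x - y)]

theorem rpow_neg_toReal_le {a b : ℝ≥0∞} (ha : a ≠ 0) (h : a ≤ b) {N : ℝ} (hN : 0 < N) :
    (b ^ (-N)).toReal ≤ (a ^ (-N)).toReal := by
  refine ENNReal.toReal_mono ?_ (ENNReal.rpow_neg_le_rpow_neg h hN.le)
  rw [ENNReal.rpow_neg]
  simp [ha, hN, hN.le]

variable [OpensMeasurableSpace H]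

theorem rieszPotential_ne_zero (ν : Measure H) [NeZero ν] {β : ℝ} (hβ : 0 < β) (x : H) (r : ℝ) :
    rieszPotential ν β x r ≠ 0 := by
  have hm : Continuous fun y => r + ‖x - y‖ := by fun_prop
  rw [rieszPotential, Ne, lintegral_eq_zero_iff (hm.measurable.ennreal_ofReal.pow_const _)]
  intro h
  have h2 : ∀ᵐ _y ∂ν, False := by
    filter_upwards [h] with y hy
    simp [ENNReal.rpow_neg, hβ, hβ.not_gt] at hy
  exact NeZero.ne ν (by simpa using h2)

theorem conformalFactor_pos (ν : Measure H) [IsFiniteMeasure ν] [NeZero ν] {β N : ℝ} (hβ : 0 < β)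
    (hN : 0 < N) (x : H) {r : ℝ} (hr : 0 < r) :
    0 < conformalFactor ν β N x r := by
  have h0 := rieszPotential_ne_zero ν hβ x r
  have h1 := rieszPotential_ne_top ν hβ x hr
  refine ENNReal.toReal_pos ?_ ?_
  · simp [ENNReal.rpow_neg, hN.le, h1]
  · simp [ENNReal.rpow_neg, hN, hN.le, h0]

theorem conformalFactor_mono (ν : Measure H) [NeZero ν] {β N : ℝ} (hβ : 0 < β)
    (hN : 0 < N) (x : H) {r R : ℝ} (h : r ≤ R) :
    conformalFactor ν β N x r ≤ conformalFactor ν β N x R :=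
  rpow_neg_toReal_le (rieszPotential_ne_zero ν hβ x R) (rieszPotential_anti ν hβ x h) hN

theorem conformalFactor_mul_le (ν : Measure H) [NeZero ν] {β N : ℝ} (hβ : 0 < β)
    (hN : 0 < N) (x : H) {r t : ℝ}
    (ht : 1 ≤ t) :
    conformalFactor ν β N x (t * r) ≤ t ^ (β * N) * conformalFactor ν β N x r := by
  have h := rieszPotential_le_mul ν hβ x (r := r) ht
  have h2 := rpow_neg_toReal_le (rieszPotential_ne_zero ν hβ x r) h hN
  have ht0 : 0 < t := by linarith
  rw [ENNReal.ofReal_rpow_of_pos ht0, ENNReal.mul_rpow_of_ne_zero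
    (by simpa using Real.rpow_pos_of_pos ht0 β) (rieszPotential_ne_zero ν hβ x _),
    ENNReal.ofReal_rpow_of_pos (Real.rpow_pos_of_pos ht0 β), ENNReal.toReal_mul,
    ENNReal.toReal_ofReal (by positivity), ← Real.rpow_mul ht0.le, mul_neg,
    Real.rpow_neg ht0.le] at h2
  rwa [inv_mul_le_iff₀ (Real.rpow_pos_of_pos ht0 _)] at h2

/-- For `t ≤ 1` monotonicity in the scale gives the factor `t`; for `t ≥ 1` the growth bound gives
`t ^ (1 + β * N)`. The sum serves both cases and becomes the gauge `η` of quasisymmetry. -/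
theorem mul_conformalFactor_le (ν : Measure H) [IsFiniteMeasure ν] [NeZero ν] {β N : ℝ}
    (hβ : 0 < β) (hN : 0 < N) (x : H) {r R t : ℝ} (hR : 0 < R) (ht : 0 < t) (h : r ≤ t * R) :
    r * conformalFactor ν β N x r ≤
      (t + t ^ (1 + β * N)) * (R * conformalFactor ν β N x R) := by
  have h0 := conformalFactor_pos ν hβ hN x hR
  rcases le_total t 1 with h1 | h1
  · calc r * conformalFactor ν β N x r ≤ (t * R) * conformalFactor ν β N x R := by
          refine mul_le_mul h (conformalFactor_mono ν hβ hN x ?_) ENNReal.toReal_nonneg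
            (by positivity)
          nlinarith
      _ = (t + 0) * (R * conformalFactor ν β N x R) := by ring
      _ ≤ _ := by gcongr; positivity
  · calc r * conformalFactor ν β N x r
        ≤ (t * R) * (t ^ (β * N) * conformalFactor ν β N x R) := by
          refine mul_le_mul h ?_ ENNReal.toReal_nonneg (by positivity)
          exact (conformalFactor_mono ν hβ hN x h).trans (conformalFactor_mul_le ν hβ hN x h1)
      _ = (0 + t ^ (1 + β * N)) * (R * conformalFactor ν β N x R) := by
          rw [Real.rpow_add ht, Real.rpow_one]; ring
      _ ≤ _ := by gcongr

end RieszPotential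

/-! ### Slab potentials and the increments of the monotone map -/

section MonotoneMap

variable {H : Type*} [NormedAddCommGroup H] [InnerProductSpace ℝ H] [MeasurableSpace H]

/-- The Riesz potential of order `β` on the line of the image of `ν` under `⟪·, v⟫`. -/
noncomputable def slabPotential (ν : Measure H) (β : ℝ) (v : H) (t : ℝ) : ℝ≥0∞ :=
  ∫⁻ y, ENNReal.ofReal |t - inner ℝ y v| ^ (-β) ∂ν

/-- The power `-N` of the slab potential, a Muckenhoupt weight on the line for each `v`. -/
noncomputable def slabWeight (ν : Measure H) (β N : ℝ) (v : H) (t : ℝ) : ℝ :=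
  (slabPotential ν β v t ^ (-N)).toReal

/-- Projection to a vector of norm at most `1` does not increase distances, and the smoothing radius
absorbs the offset of `t` from `⟪x, v⟫`. -/
theorem rieszPotential_le_slabPotential (ν : Measure H) {β : ℝ} (hβ : 0 < β) {x v : H} {r t : ℝ}
    (hv : ‖v‖ ≤ 1) (ht : |t - inner ℝ x v| ≤ r) :
    rieszPotential ν β x r ≤ slabPotential ν β v t := by
  refine lintegral_mono fun y => ENNReal.rpow_neg_le_rpow_neg (ENNReal.ofReal_le_ofReal ?_) hβ.le
  have h1 : |inner ℝ (x - y) v| ≤ ‖x - y‖ :=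
    (abs_real_inner_le_norm _ _).trans (mul_le_of_le_one_right (norm_nonneg _) hv)
  rw [inner_sub_left] at h1
  have h2 := abs_add_le (t - inner ℝ x v) (inner ℝ x v - inner ℝ y v)
  rw [sub_add_sub_cancel] at h2
  linarith

theorem slabWeight_nonneg (ν : Measure H) (β N : ℝ) (v : H) (t : ℝ) : 0 ≤ slabWeight ν β N v t :=
  ENNReal.toReal_nonneg

variable [BorelSpace H]

theorem slabWeight_le (ν : Measure H) [NeZero ν] {β N : ℝ} (hβ : 0 < β) (hN : 0 < N) {x v : H} {r t : ℝ}
    (hv : ‖v‖ ≤ 1) (ht : |t - inner ℝ x v| ≤ r) :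
    slabWeight ν β N v t ≤ conformalFactor ν β N x r :=
  rpow_neg_toReal_le (rieszPotential_ne_zero ν hβ x r)
    (rieszPotential_le_slabPotential ν hβ hv ht) hN

/-- The integrand in the formula for the increment of `monotoneMap` from `x` to `y`. -/
noncomputable def slabWeightAlong (ν : Measure H) (β N : ℝ) (x y : H) (p : H × ℝ) : ℝ :=
  slabWeight ν β N p.1 (inner ℝ (x + p.2 • (y - x)) p.1)

theorem slabWeightAlong_le (ν : Measure H) [NeZero ν] {β N : ℝ} (hβ : 0 < β)
    (hN : 0 < N) (x y : H) {p : H × ℝ}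
    (hp : ‖p.1‖ ≤ 1 ∧ p.2 ∈ Ioc (0 : ℝ) 1) :
    slabWeightAlong ν β N x y p ≤ conformalFactor ν β N x ‖y - x‖ := by
  refine slabWeight_le ν hβ hN hp.1 ?_
  rw [← inner_sub_left, add_sub_cancel_left]
  refine (abs_real_inner_le_norm _ _).trans ?_
  rw [norm_smul, Real.norm_of_nonneg hp.2.1.le]
  have h0 := norm_nonneg (y - x)
  calc p.2 * ‖y - x‖ * ‖p.1‖ ≤ 1 * ‖y - x‖ * 1 := by
        gcongr
        · exact hp.2.2
        · exact hp.1
    _ = _ := by ring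

theorem norm_increment_le (ν : Measure H) [NeZero ν] {β N : ℝ} (hβ : 0 < β)
    (hN : 0 < N) (x y : H) {p : H × ℝ}
    (hp : ‖p.1‖ ≤ 1 ∧ p.2 ∈ Ioc (0 : ℝ) 1) :
    ‖(inner ℝ (y - x) p.1 * slabWeightAlong ν β N x y p) • p.1‖ ≤
      ‖y - x‖ * conformalFactor ν β N x ‖y - x‖ := by
  have h1 : |inner ℝ (y - x) p.1| ≤ ‖y - x‖ :=
    (abs_real_inner_le_norm _ _).trans (mul_le_of_le_one_right (norm_nonneg _) hp.1)
  have h2 := slabWeightAlong_le ν hβ hN x y hp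
  have h3 : 0 ≤ slabWeightAlong ν β N x y p := slabWeight_nonneg _ _ _ _ _
  rw [norm_smul, norm_mul, Real.norm_eq_abs, Real.norm_of_nonneg h3]
  calc _ ≤ ‖y - x‖ * conformalFactor ν β N x ‖y - x‖ * 1 := by
        refine mul_le_mul (mul_le_mul h1 h2 h3 (norm_nonneg _)) hp.1 (norm_nonneg _) ?_
        exact mul_nonneg (norm_nonneg _) (h3.trans h2)
    _ = _ := mul_one _

variable [FiniteDimensional ℝ H] (ν : Measure H) [IsFiniteMeasure ν] {β N : ℝ}

theorem measurable_slabPotential : Measurable fun p : H × ℝ => slabPotential ν β p.1 p.2 := by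
  unfold slabPotential
  exact Measurable.lintegral_prod_right' (f := fun q : (H × ℝ) × H =>
    ENNReal.ofReal |q.1.2 - inner ℝ q.2 q.1.1| ^ (-β)) (by fun_prop)

theorem measurable_slabWeight : Measurable fun p : H × ℝ => slabWeight ν β N p.1 p.2 :=
  ((measurable_slabPotential ν).pow_const _).ennreal_toReal

/-- The map `x ↦ ∫ g_v(⟪x, v⟫) v dv` over the unit ball, where `g_v` is the primitive of the
slab weight. It is the gradient of a convex function. -/
noncomputable def monotoneMap (ν : Measure H) (β N : ℝ) (x : H) : H :=
  ∫ v in Metric.closedBall (0 : H) 1, (∫ s in (0 : ℝ)..inner ℝ x v, slabWeight ν β N v s) • v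

/-- The product of Lebesgue measure on the unit ball and on the unit interval. -/
noncomputable abbrev ballSegment (H : Type*) [NormedAddCommGroup H] [InnerProductSpace ℝ H]
    [FiniteDimensional ℝ H] [MeasurableSpace H] [BorelSpace H] : Measure (H × ℝ) :=
  (volume.restrict (Metric.closedBall (0 : H) 1)).prod (volume.restrict (Ioc (0 : ℝ) 1))

instance : IsFiniteMeasure (volume.restrict (Metric.closedBall (0 : H) 1)) :=
  ⟨by simpa using measure_closedBall_lt_top⟩

theorem ae_ballSegment : ∀ᵐ p ∂(ballSegment H), ‖p.1‖ ≤ 1 ∧ p.2 ∈ Ioc (0 : ℝ) 1 := by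
  rw [ballSegment, Measure.prod_restrict]
  filter_upwards [ae_restrict_mem (measurableSet_closedBall.prod measurableSet_Ioc)] with p hp
  exact ⟨by simpa using hp.1, hp.2⟩

/-- The converse of `rieszPotential_le_slabPotential` on average. For a fixed point `z` of the
measure, integrating over `v` turns the slab kernel into the radial one, and integrating along the
segment smooths the latter at scale `‖y - x‖`. -/
theorem exists_lintegral_slabPotential_le (hβ0 : 0 < β) (hβ1 : β < 1) :
    ∃ C : ℝ≥0, ∀ x y : H, x ≠ y →
      ∫⁻ p, slabPotential ν β p.1 (inner ℝ (x + p.2 • (y - x)) p.1) ∂(ballSegment H) ≤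
        C * rieszPotential ν β x ‖y - x‖ := by
  obtain ⟨C₁, hC₁⟩ := exists_lintegral_ball_abs_inner_rpow_le (H := H) hβ0 hβ1
  obtain ⟨C₂, hC₂⟩ := exists_lintegral_Ioc_norm_add_smul_rpow_le (H := H) hβ0 hβ1
  refine ⟨C₁ * C₂, fun x y hxy => ?_⟩
  have hm : Measurable fun q : (H × ℝ) × H =>
      ENNReal.ofReal |inner ℝ (x + q.1.2 • (y - x) - q.2) q.1.1| ^ (-β) := by fun_prop
  calc ∫⁻ p, slabPotential ν β p.1 (inner ℝ (x + p.2 • (y - x)) p.1) ∂(ballSegment H)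
      = ∫⁻ p, ∫⁻ z, ENNReal.ofReal |inner ℝ (x + p.2 • (y - x) - z) p.1| ^ (-β) ∂ν
        ∂(ballSegment H) := by
        simp only [slabPotential, inner_sub_left]
    _ = ∫⁻ z, ∫⁻ p, ENNReal.ofReal |inner ℝ (x + p.2 • (y - x) - z) p.1| ^ (-β)
        ∂(ballSegment H) ∂ν := lintegral_lintegral_swap hm.aemeasurable
    _ = ∫⁻ z, (∫⁻ τ in Ioc (0 : ℝ) 1, ∫⁻ v in Metric.closedBall (0 : H) 1,
        ENNReal.ofReal |inner ℝ (x + τ • (y - x) - z) v| ^ (-β)) ∂ν := by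
        refine lintegral_congr fun z => lintegral_prod_symm _ ?_
        exact (hm.comp (measurable_id.prodMk measurable_const)).aemeasurable
    _ ≤ ∫⁻ z, (∫⁻ τ in Ioc (0 : ℝ) 1, C₁ * ENNReal.ofReal ‖x - z + τ • (y - x)‖ ^ (-β)) ∂ν := by
        refine lintegral_mono fun z => lintegral_mono fun τ => ?_
        have h : x + τ • (y - x) - z = (x - z) + τ • (y - x) := by abel
        simp only [h]
        exact hC₁ _
    _ = ∫⁻ z, C₁ * (∫⁻ τ in Ioc (0 : ℝ) 1, ENNReal.ofReal ‖x - z + τ • (y - x)‖ ^ (-β)) ∂ν := by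
        refine lintegral_congr fun z => lintegral_const_mul _ (by fun_prop)
    _ ≤ ∫⁻ z, C₁ * (C₂ * ENNReal.ofReal (‖y - x‖ + ‖x - z‖) ^ (-β)) ∂ν := by
        refine lintegral_mono fun z => mul_le_mul_right (hC₂ _ _ ?_) _
        exact sub_ne_zero.2 hxy.symm
    _ = (C₁ * C₂ : ℝ≥0) * rieszPotential ν β x ‖y - x‖ := by
        simp only [← mul_assoc, rieszPotential]
        rw [lintegral_const_mul _ (by fun_prop), ENNReal.coe_mul]

theorem measurable_slabWeightAlong (x y : H) : Measurable (slabWeightAlong ν β N x y) :=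
  (measurable_slabWeight ν).comp (g := fun p : H × ℝ => slabWeight ν β N p.1 p.2)
    (f := fun p : H × ℝ => (p.1, inner ℝ (x + p.2 • (y - x)) p.1)) (by fun_prop)

variable [NeZero ν]

theorem integrable_increment (hβ : 0 < β) (hN : 0 < N) (x y : H) :
    Integrable (fun p : H × ℝ => (inner ℝ (y - x) p.1 * slabWeightAlong ν β N x y p) • p.1)
      (ballSegment H) := by
  refine Integrable.of_bound (C := ‖y - x‖ * conformalFactor ν β N x ‖y - x‖) ?_ ?_
  · have := measurable_slabWeightAlong ν (β := β) (N := N) x y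
    exact Measurable.aestronglyMeasurable (by fun_prop)
  · filter_upwards [ae_ballSegment] with p hp using norm_increment_le ν hβ hN x y hp

theorem intervalIntegrable_slabWeight (hβ : 0 < β) (hN : 0 < N) {v : H} (hv : ‖v‖ ≤ 1) (a b : ℝ) :
    IntervalIntegrable (slabWeight ν β N v) volume a b := by
  rw [intervalIntegrable_iff]
  have hm : Measurable (slabWeight ν β N v) :=
    (measurable_slabWeight ν).comp (g := fun p : H × ℝ => slabWeight ν β N p.1 p.2)
      (f := fun t : ℝ => (v, t)) (by fun_prop)
  refine Measure.integrableOn_of_bounded (M := conformalFactor ν β N (0 : H) (max |a| |b|))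
    (by simp [uIoc]) hm.aestronglyMeasurable ?_
  filter_upwards [ae_restrict_mem measurableSet_uIoc] with t ht
  rw [Real.norm_of_nonneg (slabWeight_nonneg _ _ _ _ _)]
  refine slabWeight_le ν hβ hN hv ?_
  simp only [inner_zero_left, sub_zero]
  obtain ⟨h1, h2⟩ := uIoc_subset_uIcc ht
  rw [abs_le]
  constructor
  · refine le_trans ?_ h1
    rw [neg_le]
    rcases min_choice a b with h | h <;> rw [h]
    · exact (neg_le_abs a).trans (le_max_left _ _)
    · exact (neg_le_abs b).trans (le_max_right _ _)
  · exact h2.trans (max_le_max (le_abs_self a) (le_abs_self b))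

/-- Substitution `s = ⟪x, v⟫ + τ ⟪y - x, v⟫`. -/
theorem integral_slabWeight_sub (hβ : 0 < β) (hN : 0 < N) (x y : H) {v : H} (hv : ‖v‖ ≤ 1) :
    (∫ s in (0 : ℝ)..inner ℝ y v, slabWeight ν β N v s) -
      (∫ s in (0 : ℝ)..inner ℝ x v, slabWeight ν β N v s) =
      ∫ τ in Ioc (0 : ℝ) 1, inner ℝ (y - x) v * slabWeightAlong ν β N x y (v, τ) := by
  rw [intervalIntegral.integral_interval_sub_left
    (intervalIntegrable_slabWeight ν hβ hN hv _ _) (intervalIntegrable_slabWeight ν hβ hN hv _ _),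
    integral_const_mul, ← intervalIntegral.integral_of_le zero_le_one]
  have h := intervalIntegral.mul_integral_comp_mul_add (a := 0) (b := 1)
    (f := slabWeight ν β N v) (c := inner ℝ (y - x) v) (d := inner ℝ x v)
  have h2 : inner ℝ (y - x) v * 1 + inner ℝ x v = inner ℝ y v := by
    rw [inner_sub_left]; ring
  rw [mul_zero, zero_add, h2] at h
  rw [← h]
  congr 1
  refine intervalIntegral.integral_congr fun τ _ => ?_
  simp only [slabWeightAlong]
  congr 1
  rw [inner_add_left, inner_smul_left]
  simp only [conj_trivial]
  ring

theorem integrableOn_monotoneMap (hβ : 0 < β) (hN : 0 < N) (x : H) :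
    IntegrableOn (fun v => (∫ s in (0 : ℝ)..inner ℝ x v, slabWeight ν β N v s) • v)
      (Metric.closedBall (0 : H) 1) := by
  refine (integrable_increment ν hβ hN 0 x).integral_prod_left.congr ?_
  filter_upwards [ae_restrict_mem measurableSet_closedBall] with v hv
  have h := integral_slabWeight_sub ν hβ hN 0 x (by simpa using hv)
  simp only [inner_zero_left, intervalIntegral.integral_same, sub_zero] at h
  rw [h, ← integral_smul_const]
  simp

theorem monotoneMap_sub (hβ : 0 < β) (hN : 0 < N) (x y : H) :
    monotoneMap ν β N y - monotoneMap ν β N x =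
      ∫ p, (inner ℝ (y - x) p.1 * slabWeightAlong ν β N x y p) • p.1 ∂(ballSegment H) := by
  rw [monotoneMap, monotoneMap, ← integral_sub (integrableOn_monotoneMap ν hβ hN y)
    (integrableOn_monotoneMap ν hβ hN x), integral_prod _ (integrable_increment ν hβ hN x y)]
  refine setIntegral_congr_fun measurableSet_closedBall fun v hv => ?_
  simp only
  rw [← sub_smul, integral_slabWeight_sub ν hβ hN x y (by simpa using hv), integral_smul_const]

theorem norm_monotoneMap_sub_le (hβ : 0 < β) (hN : 0 < N) (x y : H) :
    ‖monotoneMap ν β N y - monotoneMap ν β N x‖ ≤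
      (ballSegment H).real univ * (‖y - x‖ * conformalFactor ν β N x ‖y - x‖) := by
  rw [monotoneMap_sub ν hβ hN, mul_comm]
  refine norm_integral_le_of_norm_le_const ?_
  filter_upwards [ae_ballSegment] with p hp using norm_increment_le ν hβ hN x y hp

theorem inner_monotoneMap_sub (hβ : 0 < β) (hN : 0 < N) (x y : H) :
    ENNReal.ofReal (inner ℝ (monotoneMap ν β N y - monotoneMap ν β N x) (y - x)) =
      ∫⁻ p, ENNReal.ofReal (inner ℝ (y - x) p.1 ^ 2 * slabWeightAlong ν β N x y p)
        ∂(ballSegment H) := by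
  have hint := integrable_increment ν hβ hN x y
  rw [monotoneMap_sub ν hβ hN, real_inner_comm, ← integral_inner hint]
  have h : ∀ p : H × ℝ, inner ℝ (y - x) ((inner ℝ (y - x) p.1 * slabWeightAlong ν β N x y p) • p.1)
      = inner ℝ (y - x) p.1 ^ 2 * slabWeightAlong ν β N x y p := by
    intro p
    rw [inner_smul_right]; ring
  have hi := hint.const_inner (𝕜 := ℝ) (y - x)
  simp only [h] at hi ⊢
  exact ofReal_integral_eq_lintegral_ofReal hi
    (Eventually.of_forall fun p => mul_nonneg (sq_nonneg _) (slabWeight_nonneg _ _ _ _ _))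

end MonotoneMap

/-! ### From two-sided estimates to a quasisymmetric homeomorphism -/

section Homeomorph

variable {H : Type*} [NormedAddCommGroup H] [InnerProductSpace ℝ H]

/-- A continuous injective proper map which turns every direction by an angle bounded away from
`π / 2` is surjective: a point closest to a given value can be moved closer. -/
theorem surjective_of_inner_sub_ge [ProperSpace H] {f : H → H} (hf : Continuous f)
    (hinj : Function.Injective f) (hproper : Tendsto f (cocompact H) (cocompact H)) {δ : ℝ}
    (hδ : 0 < δ)
    (hmono : ∀ x y, δ * (‖f y - f x‖ * ‖y - x‖) ≤ inner ℝ (f y - f x) (y - x)) :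
    Function.Surjective f := by
  intro p
  have hlim : Tendsto (fun x => ‖f x - p‖) (cocompact H) atTop := by
    have h1 : Tendsto (fun x : H => ‖x‖ - ‖p‖) (cocompact H) atTop :=
      tendsto_atTop_add_const_right _ (-‖p‖) (tendsto_norm_cocompact_atTop (E := H))
    exact tendsto_atTop_mono (fun x => norm_sub_norm_le (f x) p) (h1.comp hproper)
  obtain ⟨x, hx⟩ := Continuous.exists_forall_le (f := fun x => ‖f x - p‖) (by fun_prop) hlim
  by_contra! hne
  set q := p - f x with hq
  have hq0 : q ≠ 0 := sub_ne_zero.2 (hne x).symm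
  have hqpos : 0 < ‖q‖ := norm_pos_iff.2 hq0
  have htend : Tendsto (fun t : ℝ => ‖f (x + t • q) - f x‖) (𝓝[>] 0) (𝓝 0) := by
    have hc : Continuous fun t : ℝ => ‖f (x + t • q) - f x‖ := by fun_prop
    have := hc.tendsto 0
    simp only [zero_smul, add_zero, sub_self, norm_zero] at this
    exact this.mono_left nhdsWithin_le_nhds
  -- With `‖Δ‖ < 2δ‖q‖`, the difference `‖Δ - q‖² - ‖q‖² = ‖Δ‖² - 2⟪Δ, q⟫` is negative, against
  -- minimality at `x`.
  obtain ⟨t, ht, ht0⟩ := ((htend.eventually_lt_const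
    (show (0 : ℝ) < 2 * δ * ‖q‖ by positivity)).and self_mem_nhdsWithin).exists
  have ht0 : 0 < t := ht0
  set Δ := f (x + t • q) - f x with hΔ
  have hΔ0 : 0 < ‖Δ‖ := by
    refine norm_pos_iff.2 (sub_ne_zero.2 fun h => ?_)
    have := hinj h
    simp [ht0.ne', hq0] at this
  have h1 := hmono x (x + t • q)
  rw [add_sub_cancel_left, inner_smul_right, norm_smul, Real.norm_of_nonneg ht0.le, ← hΔ] at h1
  have h2 : δ * (‖Δ‖ * ‖q‖) ≤ inner ℝ Δ q := by
    refine le_of_mul_le_mul_left ?_ ht0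
    linarith
  have h3 := hx (x + t • q)
  have h4 : f (x + t • q) - p = Δ - q := by rw [hΔ, hq]; abel
  have h5 : ‖f x - p‖ = ‖q‖ := by rw [hq, norm_sub_rev]
  rw [h4, h5] at h3
  have h6 := norm_sub_sq_real Δ q
  have h7 : ‖q‖ ^ 2 ≤ ‖Δ - q‖ ^ 2 := by gcongr
  nlinarith

theorem exists_orderIso_add_rpow {K : ℝ≥0} (hK : 0 < K) {p : ℝ} (hp : 0 < p) :
    ∃ η : ℝ≥0 ≃o ℝ≥0, ∀ t, η t = K * (t + t ^ p) := by
  have hmono : StrictMono fun t : ℝ≥0 => K * (t + t ^ p) := by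
    intro a b hab
    exact mul_lt_mul_of_pos_left (add_lt_add hab (NNReal.rpow_lt_rpow hab hp)) hK
  have hsurj : Function.Surjective fun t : ℝ≥0 => K * (t + t ^ p) := by
    refine Continuous.surjective ?_ ?_ ?_
    · have := NNReal.continuous_rpow_const hp.le
      fun_prop
    · refine Tendsto.const_mul_atTop hK ?_
      exact tendsto_atTop_mono (fun t => self_le_add_right t _) tendsto_id
    · rw [OrderBot.atBot_eq, tendsto_pure_left]
      intro s hs
      have h0 : (⊥ : ℝ≥0) ∈ s := hs
      simpa [hp.ne'] using h0
  exact ⟨hmono.orderIsoOfSurjective _ hsurj, fun t => rfl⟩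

variable [FiniteDimensional ℝ H] [MeasurableSpace H] [BorelSpace H]
  (ν : Measure H) [IsFiniteMeasure ν] [NeZero ν] {β N : ℝ}

/-- A Markov argument. Where the slab potential is at most `A`, a large multiple of the Riesz
potential `U`, the weight is at least `A ^ (-N)`. The rest carries at most half of the integral of
`⟪e, v⟫²`, since there `⟪e, v⟫²` is at most the slab potential divided by `A`. -/
theorem exists_le_inner_monotoneMap_sub (hβ0 : 0 < β) (hβ1 : β < 1) (hN : 0 < N) :
    ∃ c : ℝ, 0 < c ∧ ∀ x y : H, c * (‖y - x‖ ^ 2 * conformalFactor ν β N x ‖y - x‖) ≤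
      inner ℝ (monotoneMap ν β N y - monotoneMap ν β N x) (y - x) := by
  obtain ⟨m, hm, hme⟩ := exists_le_lintegral_ball_inner_sq (H := H)
  obtain ⟨C, hC⟩ := exists_lintegral_slabPotential_le ν hβ0 hβ1
  -- Chosen so that `C * U / A ≤ m / 2` for `A = B * U`.
  set B : ℝ := 2 * (C + 1) / m with hB
  have hBpos : 0 < B := by positivity
  refine ⟨m / 2 * B ^ (-N), by positivity, fun x y => ?_⟩
  rcases eq_or_ne x y with rfl | hxy
  · simp
  set q := y - x
  have hr : 0 < ‖q‖ := norm_pos_iff.2 (sub_ne_zero.2 hxy.symm)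
  set e : H := ‖q‖⁻¹ • q with he_def
  have he : ‖e‖ = 1 := by simp [e, norm_smul, hr.ne']
  have hU0 := rieszPotential_ne_zero ν hβ0 x ‖q‖
  have hUt := rieszPotential_ne_top ν hβ0 x hr
  set U := rieszPotential ν β x ‖q‖ with hU
  have hu : 0 < U.toReal := ENNReal.toReal_pos hU0 hUt
  set A : ℝ := B * U.toReal
  have hA : 0 < A := by positivity
  set I := inner ℝ (monotoneMap ν β N y - monotoneMap ν β N x) q with hI
  have hpoint : ∀ᵐ p ∂(ballSegment H), ENNReal.ofReal (inner ℝ e p.1 ^ 2) ≤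
      ENNReal.ofReal (A ^ N * (‖q‖ ^ 2)⁻¹) *
        ENNReal.ofReal (inner ℝ q p.1 ^ 2 * slabWeightAlong ν β N x y p) +
      (ENNReal.ofReal A)⁻¹ * slabPotential ν β p.1 (inner ℝ (x + p.2 • q) p.1) := by
    filter_upwards [ae_ballSegment] with p hp
    set P := slabPotential ν β p.1 (inner ℝ (x + p.2 • q) p.1) with hP
    have heq : inner ℝ e p.1 ^ 2 = (‖q‖ ^ 2)⁻¹ * inner ℝ q p.1 ^ 2 := by
      rw [he_def, inner_smul_left]
      simp only [conj_trivial]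
      rw [mul_pow, inv_pow]
    rcases le_or_gt P (ENNReal.ofReal A) with h | h
    · refine le_trans ?_ (self_le_add_right _ _)
      rw [← ENNReal.ofReal_mul (by positivity)]
      refine ENNReal.ofReal_le_ofReal ?_
      -- If `P` were `0`, then `P ^ (-N) = ∞` and the weight would be the default value `0` of
      -- `toReal`; `0 < U ≤ P` excludes this.
      have hP0 : P ≠ 0 := by
        intro h0
        have h1 : U ≤ P := by
          refine rieszPotential_le_slabPotential ν hβ0 hp.1 ?_
          rw [← inner_sub_left, add_sub_cancel_left]
          refine (abs_real_inner_le_norm _ _).trans ?_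
          rw [norm_smul, Real.norm_of_nonneg hp.2.1.le]
          calc p.2 * ‖q‖ * ‖p.1‖ ≤ 1 * ‖q‖ * 1 := by
                gcongr
                · exact hp.2.2
                · exact hp.1
            _ = ‖q‖ := by ring
        exact hU0 (le_antisymm (h1.trans h0.le) zero_le)
      have hw : A ^ (-N) ≤ slabWeightAlong ν β N x y p := by
        have := rpow_neg_toReal_le hP0 h hN
        rwa [ENNReal.ofReal_rpow_of_pos hA, ENNReal.toReal_ofReal (by positivity)] at this
      rw [Real.rpow_neg hA.le, inv_le_iff_one_le_mul₀' (by positivity)] at hw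
      rw [heq]
      have h2 : 0 ≤ (‖q‖ ^ 2)⁻¹ * inner ℝ q p.1 ^ 2 := by positivity
      calc _ = (‖q‖ ^ 2)⁻¹ * inner ℝ q p.1 ^ 2 * 1 := (mul_one _).symm
        _ ≤ (‖q‖ ^ 2)⁻¹ * inner ℝ q p.1 ^ 2 * (A ^ N * slabWeightAlong ν β N x y p) := by gcongr
        _ = _ := by ring
    · refine le_trans ?_ (self_le_add_left _ _)
      calc ENNReal.ofReal (inner ℝ e p.1 ^ 2) ≤ 1 := by
            rw [ENNReal.ofReal_le_one, sq_le_one_iff_abs_le_one]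
            refine (abs_real_inner_le_norm _ _).trans ?_
            rw [he, one_mul]
            exact hp.1
        _ = (ENNReal.ofReal A)⁻¹ * ENNReal.ofReal A :=
            (ENNReal.inv_mul_cancel (by simpa using hA) (by simp)).symm
        _ ≤ _ := by gcongr
  have hmain : ENNReal.ofReal m ≤
      ENNReal.ofReal (A ^ N * (‖q‖ ^ 2)⁻¹) * ENNReal.ofReal I + ENNReal.ofReal (m / 2) := by
    calc ENNReal.ofReal m
        ≤ ∫⁻ v in Metric.closedBall (0 : H) 1, ENNReal.ofReal (inner ℝ e v ^ 2) := hme e he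
      _ = ∫⁻ p, ENNReal.ofReal (inner ℝ e p.1 ^ 2) ∂(ballSegment H) := by
          rw [lintegral_prod _ (by fun_prop)]
          simp
      _ ≤ ∫⁻ p, (ENNReal.ofReal (A ^ N * (‖q‖ ^ 2)⁻¹) *
            ENNReal.ofReal (inner ℝ q p.1 ^ 2 * slabWeightAlong ν β N x y p) +
          (ENNReal.ofReal A)⁻¹ * slabPotential ν β p.1 (inner ℝ (x + p.2 • q) p.1))
          ∂(ballSegment H) := lintegral_mono_ae hpoint
      _ = ENNReal.ofReal (A ^ N * (‖q‖ ^ 2)⁻¹) * ENNReal.ofReal I + (ENNReal.ofReal A)⁻¹ *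
          ∫⁻ p, slabPotential ν β p.1 (inner ℝ (x + p.2 • q) p.1) ∂(ballSegment H) := by
          have hmeas := measurable_slabWeightAlong ν (β := β) (N := N) x y
          rw [lintegral_add_left (by fun_prop), lintegral_const_mul _ (by fun_prop),
            lintegral_const_mul' _ _ (by simpa using hA), hI, inner_monotoneMap_sub ν hβ0 hN]
      _ ≤ _ := by
          gcongr
          calc (ENNReal.ofReal A)⁻¹ *
              ∫⁻ p, slabPotential ν β p.1 (inner ℝ (x + p.2 • q) p.1) ∂(ballSegment H)
              ≤ (ENNReal.ofReal A)⁻¹ * (C * U) := by gcongr; exact hC x y hxy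
            _ = ENNReal.ofReal (A⁻¹ * (C * U.toReal)) := by
                rw [ENNReal.ofReal_mul (inv_nonneg.2 hA.le), ENNReal.ofReal_inv_of_pos hA,
                  ENNReal.ofReal_mul C.coe_nonneg, ENNReal.ofReal_toReal hUt]
                simp
            _ ≤ _ := by
                refine ENNReal.ofReal_le_ofReal ?_
                rw [inv_mul_le_iff₀ hA]
                have : A * (m / 2) = (C + 1) * U.toReal := by
                  simp only [A, hB]; field_simp
                rw [this]
                gcongr
                linarith
  have hreal : m / 2 ≤ A ^ N * (‖q‖ ^ 2)⁻¹ * I := by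
    rw [← ENNReal.ofReal_mul (by positivity)] at hmain
    by_contra! hlt
    have h1 : ENNReal.ofReal (A ^ N * (‖q‖ ^ 2)⁻¹ * I) < ENNReal.ofReal (m / 2) :=
      (ENNReal.ofReal_lt_ofReal_iff (by positivity)).2 hlt
    have h2 := hmain.trans_lt (ENNReal.add_lt_add_right (by simp) h1)
    rw [← ENNReal.ofReal_add (by positivity) (by positivity), add_halves] at h2
    exact lt_irrefl _ h2
  have hfac : conformalFactor ν β N x ‖q‖ = U.toReal ^ (-N) := by
    rw [conformalFactor, ← ENNReal.toReal_rpow]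
  have hAN : B ^ (-N) * U.toReal ^ (-N) = (A ^ N)⁻¹ := by
    rw [← Real.mul_rpow hBpos.le hu.le, Real.rpow_neg hA.le]
  rw [hfac]
  calc m / 2 * B ^ (-N) * (‖q‖ ^ 2 * U.toReal ^ (-N))
      = (A ^ N)⁻¹ * ‖q‖ ^ 2 * (m / 2) := by rw [← hAN]; ring
    _ ≤ (A ^ N)⁻¹ * ‖q‖ ^ 2 * (A ^ N * (‖q‖ ^ 2)⁻¹ * I) := by gcongr
    _ = I := by
        have : A ^ N ≠ 0 := by positivity
        field_simp

theorem exists_le_norm_monotoneMap_sub (hβ0 : 0 < β) (hβ1 : β < 1) (hN : 0 < N) :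
    ∃ c : ℝ, 0 < c ∧ ∀ x y : H, c * (‖y - x‖ * conformalFactor ν β N x ‖y - x‖) ≤
      ‖monotoneMap ν β N y - monotoneMap ν β N x‖ := by
  obtain ⟨c, hc, h⟩ := exists_le_inner_monotoneMap_sub ν hβ0 hβ1 hN
  refine ⟨c, hc, fun x y => ?_⟩
  rcases eq_or_ne x y with rfl | hxy
  · simp
  have hr : 0 < ‖y - x‖ := norm_pos_iff.2 (sub_ne_zero.2 hxy.symm)
  refine le_of_mul_le_mul_right ?_ hr
  calc _ = c * (‖y - x‖ ^ 2 * conformalFactor ν β N x ‖y - x‖) := by ring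
    _ ≤ _ := (h x y).trans (real_inner_le_norm _ _)

theorem continuous_monotoneMap (hβ : 0 < β) (hN : 0 < N) : Continuous (monotoneMap ν β N) := by
  rw [continuous_iff_continuousAt]
  intro x
  rw [ContinuousAt, tendsto_iff_norm_sub_tendsto_zero]
  have hlim : Tendsto (fun y => (ballSegment H).real univ * (‖y - x‖ * conformalFactor ν β N x 1))
      (𝓝 x) (𝓝 0) := by
    have hc : Continuous fun y =>
        (ballSegment H).real univ * (‖y - x‖ * conformalFactor ν β N x 1) := by fun_prop
    simpa using hc.tendsto x
  refine squeeze_zero' (Eventually.of_forall fun y => norm_nonneg _) ?_ hlim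
  filter_upwards [Metric.ball_mem_nhds x one_pos] with y hy
  rw [mem_ball_iff_norm] at hy
  refine (norm_monotoneMap_sub_le ν hβ hN x y).trans ?_
  gcongr
  exact conformalFactor_mono ν hβ hN x hy.le

theorem injective_monotoneMap (hβ0 : 0 < β) (hβ1 : β < 1) (hN : 0 < N) :
    Function.Injective (monotoneMap ν β N) := by
  obtain ⟨c, hc, h⟩ := exists_le_norm_monotoneMap_sub ν hβ0 hβ1 hN
  intro x y hxy
  by_contra hne
  have hr : 0 < ‖y - x‖ := norm_pos_iff.2 (sub_ne_zero.2 (Ne.symm hne))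
  have h1 := h x y
  rw [hxy, sub_self, norm_zero] at h1
  have := conformalFactor_pos ν hβ0 hN x hr
  exact absurd h1 (not_le.2 (by positivity))

/-- The factor increases with the scale, so for `‖y‖ ≥ 1` the lower bound grows at least linearly in
`‖y‖`. -/
theorem tendsto_monotoneMap_cocompact (hβ0 : 0 < β) (hβ1 : β < 1) (hN : 0 < N) :
    Tendsto (monotoneMap ν β N) (cocompact H) (cocompact H) := by
  obtain ⟨c, hc, h⟩ := exists_le_norm_monotoneMap_sub ν hβ0 hβ1 hN
  have hΦ := conformalFactor_pos ν hβ0 hN (0 : H) one_pos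
  rw [← Metric.cobounded_eq_cocompact, ← tendsto_norm_atTop_iff_cobounded]
  have hlim : Tendsto (fun y : H => c * conformalFactor ν β N (0 : H) 1 * ‖y‖ -
      ‖monotoneMap ν β N 0‖) (Bornology.cobounded H) atTop :=
    tendsto_atTop_add_const_right _ (-‖monotoneMap ν β N 0‖)
      (tendsto_norm_cobounded_atTop.const_mul_atTop (by positivity))
  refine tendsto_atTop_mono' _ ?_ hlim
  filter_upwards [tendsto_norm_cobounded_atTop.eventually_ge_atTop 1] with y hy
  have h1 := h 0 y
  rw [sub_zero] at h1
  have h2 := norm_sub_le (monotoneMap ν β N y) (monotoneMap ν β N 0)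
  have h3 : c * conformalFactor ν β N (0 : H) 1 * ‖y‖ ≤
      c * (‖y‖ * conformalFactor ν β N (0 : H) ‖y‖) := by
    rw [mul_assoc, mul_comm (conformalFactor ν β N (0 : H) 1)]
    gcongr
    exact conformalFactor_mono ν hβ0 hN 0 hy
  linarith

/-- For a nonzero finite measure `ν` there is a quasisymmetric homeomorphism which near `x` and at
scale `r` stretches at most by a constant times the power `-N` of the potential of `ν`. -/
theorem exists_isQuasisymmetric_norm_sub_le (hβ0 : 0 < β) (hβ1 : β < 1) (hN : 0 < N) :
    ∃ f : H ≃ₜ H, IsQuasisymmetric f ∧ ∃ C : ℝ, 0 ≤ C ∧ ∀ x y : H,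
      ‖f y - f x‖ ≤ C * (‖y - x‖ * conformalFactor ν β N x ‖y - x‖) := by
  set V := (ballSegment H).real univ with hV
  have hV0 : 0 ≤ V := measureReal_nonneg
  have hcont := continuous_monotoneMap ν hβ0 hN
  have hinj := injective_monotoneMap ν hβ0 hβ1 hN
  have hproper := tendsto_monotoneMap_cocompact ν hβ0 hβ1 hN
  have hupper := norm_monotoneMap_sub_le ν hβ0 hN
  obtain ⟨c, hc, hlower⟩ := exists_le_norm_monotoneMap_sub ν hβ0 hβ1 hN
  have hsurj : Function.Surjective (monotoneMap ν β N) := by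
    obtain ⟨c', hc', hinner⟩ := exists_le_inner_monotoneMap_sub ν hβ0 hβ1 hN
    -- The angle bound is the quotient of the lower bound for the inner product by the upper bound
    -- for the norm; `V + 1` replaces `V` for positivity.
    refine surjective_of_inner_sub_ge hcont hinj hproper (δ := c' / (V + 1)) (by positivity)
      fun x y => ?_
    refine le_trans ?_ (hinner x y)
    have h0 : 0 ≤ conformalFactor ν β N x ‖y - x‖ := ENNReal.toReal_nonneg
    rw [div_mul_eq_mul_div, div_le_iff₀ (by positivity)]
    calc c' * (‖monotoneMap ν β N y - monotoneMap ν β N x‖ * ‖y - x‖)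
        ≤ c' * (((V + 1) * (‖y - x‖ * conformalFactor ν β N x ‖y - x‖)) * ‖y - x‖) := by
          gcongr
          refine (hupper x y).trans ?_
          gcongr
          linarith
      _ = _ := by ring
  have hclosed : IsClosedMap (monotoneMap ν β N) :=
    (isProperMap_iff_tendsto_cocompact.2 ⟨hcont, hproper⟩).isClosedMap
  let f : H ≃ₜ H := (Equiv.ofBijective _ ⟨hinj, hsurj⟩).toHomeomorphOfContinuousClosed hcont hclosed
  have hf : ∀ x, f x = monotoneMap ν β N x := fun x => rfl
  refine ⟨f, ?_, V, hV0, fun x y => by simpa only [hf] using hupper x y⟩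
  obtain ⟨η, hη⟩ := exists_orderIso_add_rpow (K := ((V + 1) / c).toNNReal)
    (Real.toNNReal_pos.2 (by positivity)) (p := 1 + β * N) (by positivity)
  refine ⟨η, fun x y z t ht hxyz => ?_⟩
  rcases eq_or_ne x z with rfl | hxz
  · have : x = y := by simpa using hxyz
    simp [this]
  have hz : 0 < ‖z - x‖ := norm_pos_iff.2 (sub_ne_zero.2 hxz.symm)
  have ht' : (0 : ℝ) < t := ht
  rw [← NNReal.coe_le_coe] at hxyz ⊢
  simp only [hη, NNReal.coe_mul, NNReal.coe_add, coe_nndist, NNReal.coe_rpow,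
    Real.coe_toNNReal ((V + 1) / c) (by positivity), dist_eq_norm_sub', hf] at hxyz ⊢
  calc ‖monotoneMap ν β N y - monotoneMap ν β N x‖
      ≤ V * (‖y - x‖ * conformalFactor ν β N x ‖y - x‖) := hupper x y
    _ ≤ (V + 1) * (((t : ℝ) + (t : ℝ) ^ (1 + β * N)) *
        (‖z - x‖ * conformalFactor ν β N x ‖z - x‖)) := by
        have := mul_conformalFactor_le ν hβ0 hN x hz ht' hxyz
        refine mul_le_mul (by linarith) this ?_ (by positivity)
        exact mul_nonneg (norm_nonneg _) ENNReal.toReal_nonneg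
    _ = (V + 1) / c * ((t : ℝ) + (t : ℝ) ^ (1 + β * N)) *
        (c * (‖z - x‖ * conformalFactor ν β N x ‖z - x‖)) := by field_simp
    _ ≤ _ := by
        exact mul_le_mul_of_nonneg_left (hlower x z) (by positivity)

end Homeomorph

/-! ### Covers and covering numbers -/

section Covers

variable {H : Type*} [NormedAddCommGroup H]

theorem diamCoveringNumber_mono {X : Type*} [MetricSpace X] {F G : Set X} (h : F ⊆ G) (r : ℝ) :
    diamCoveringNumber F r ≤ diamCoveringNumber G r :=
  le_iInf₂ fun 𝒰 h𝒰 => iInf₂_le 𝒰 ⟨h.trans h𝒰.1, h𝒰.2⟩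

theorem diamCoveringNumber_image_le {X Y : Type*} [MetricSpace Y] {E : Set X} {f : X → Y}
    {𝒰 : Set (Set X)} (hE : E ⊆ ⋃₀ 𝒰) {r : ℝ}
    (h𝒰 : ∀ A ∈ 𝒰, Metric.ediam (f '' A) ≤ ENNReal.ofReal r) :
    diamCoveringNumber (f '' E) r ≤ 𝒰.encard := by
  refine (iInf₂_le ((f '' ·) '' 𝒰) ⟨?_, ?_⟩).trans (encard_image_le _ _)
  · rintro _ ⟨x, hx, rfl⟩
    obtain ⟨A, hA, hxA⟩ := hE hx
    exact ⟨f '' A, mem_image_of_mem _ hA, mem_image_of_mem f hxA⟩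
  · rintro _ ⟨A, hA, rfl⟩
    exact h𝒰 A hA

theorem diamCoveringNumber_univ_coe_le {X : Type*} [MetricSpace X] (F : Set X) (r : ℝ) :
    diamCoveringNumber (univ : Set F) r ≤ diamCoveringNumber F r := by
  refine le_iInf₂ fun 𝒰 h𝒰 => ?_
  refine (iInf₂_le ((fun A => ((↑) : F → X) ⁻¹' A) '' 𝒰) ⟨?_, ?_⟩).trans (encard_image_le _ _)
  · rintro ⟨x, hx⟩ -
    obtain ⟨A, hA, hxA⟩ := h𝒰.1 hx
    exact ⟨_, mem_image_of_mem _ hA, hxA⟩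
  · rintro _ ⟨A, hA, rfl⟩
    refine le_trans (Metric.ediam_le fun x hx y hy => ?_) (h𝒰.2 A hA)
    exact Metric.edist_le_ediam_of_mem (s := A) hx hy

/-- Each term of the sum is at least `d ^ s`. This turns the lower bound on diameters in the
intermediate dimension into a cardinality. -/
theorem encard_le_of_tsum_ediam_le {X : Type*} [MetricSpace X] {𝒰 : Set (Set X)} {d s C : ℝ}
    (hd : 0 < d) (hs : 0 < s) (h𝒰 : ∀ A ∈ 𝒰, ENNReal.ofReal d ≤ Metric.ediam A)
    (hsum : ∑' A : 𝒰, Metric.ediam (A : Set X) ^ s ≤ ENNReal.ofReal C) :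
    (𝒰.encard : ℝ≥0∞) ≤ ENNReal.ofReal (C * d ^ (-s)) := by
  have h1 : (𝒰.encard : ℝ≥0∞) * ENNReal.ofReal (d ^ s) ≤ ENNReal.ofReal C := by
    rw [← ENNReal.tsum_set_const]
    refine le_trans (ENNReal.tsum_le_tsum fun A => ?_) hsum
    rw [← ENNReal.ofReal_rpow_of_pos hd]
    exact ENNReal.rpow_le_rpow (h𝒰 A A.2) hs.le
  have hds : 0 < d ^ s := by positivity
  rw [Real.rpow_neg hd.le, ← div_eq_mul_inv, ENNReal.ofReal_div_of_pos hds]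
  rwa [ENNReal.le_div_iff_mul_le (Or.inl (by simpa using hds)) (Or.inl (by simp))]

variable [MeasurableSpace H]

/-- On the ball the kernel is at least `(2 * ρ) ^ (-β)`, so the potential is at least `(2 * ρ) ^
(-β) * ρ ^ s`. For `s < β` the factor is then small at small scales. -/
theorem conformalFactor_le_of_le_measure [OpensMeasurableSpace H] (ν : Measure H) {β N s ρ : ℝ}
    (hβ : 0 < β) (hN : 0 < N) (hρ : 0 < ρ) {x : H}
    (hν : ENNReal.ofReal ρ ^ s ≤ ν (Metric.closedBall x ρ)) :
    conformalFactor ν β N x ρ ≤ 2 ^ (β * N) * ρ ^ ((β - s) * N) := by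
  have h2ρ : 0 < 2 * ρ := by positivity
  have hle : ENNReal.ofReal ((2 * ρ) ^ (-β) * ρ ^ s) ≤ rieszPotential ν β x ρ := by
    calc ENNReal.ofReal ((2 * ρ) ^ (-β) * ρ ^ s)
        = ENNReal.ofReal (2 * ρ) ^ (-β) * ENNReal.ofReal ρ ^ s := by
          rw [ENNReal.ofReal_mul (by positivity), ENNReal.ofReal_rpow_of_pos h2ρ,
            ENNReal.ofReal_rpow_of_pos hρ]
      _ ≤ ENNReal.ofReal (2 * ρ) ^ (-β) * ν (Metric.closedBall x ρ) := by gcongr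
      _ = ∫⁻ _y in Metric.closedBall x ρ, ENNReal.ofReal (2 * ρ) ^ (-β) ∂ν := by simp
      _ ≤ ∫⁻ y in Metric.closedBall x ρ, ENNReal.ofReal (ρ + ‖x - y‖) ^ (-β) ∂ν := by
          refine setLIntegral_mono' measurableSet_closedBall fun y hy => ?_
          refine ENNReal.rpow_neg_le_rpow_neg (ENNReal.ofReal_le_ofReal ?_) hβ.le
          rw [mem_closedBall_iff_norm'] at hy
          linarith
      _ ≤ _ := setLIntegral_le_lintegral _ _
  have hpos : 0 < (2 * ρ) ^ (-β) * ρ ^ s := by positivity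
  refine (rpow_neg_toReal_le (by simpa using hpos) hle hN).trans_eq ?_
  rw [ENNReal.ofReal_rpow_of_pos hpos, ENNReal.toReal_ofReal (by positivity),
    Real.mul_rpow (by positivity) (by positivity), ← Real.rpow_mul h2ρ.le, ← Real.rpow_mul hρ.le,
    Real.mul_rpow (by norm_num) hρ.le, mul_assoc, ← Real.rpow_add hρ]
  ring_nf

/-- Point masses at the members of a sequence of covers. -/
theorem exists_measure_ediam_rpow_le (𝒰 : ℕ → Set (Set H)) {s t C : ℝ} (hst : s < t)
    (hdiam : ∀ k, ∀ A ∈ 𝒰 k, 0 < Metric.ediam A ∧ Metric.ediam A ≤ 2⁻¹ ^ k)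
    (hsum : ∀ k, ∑' A : 𝒰 k, Metric.ediam (A : Set H) ^ s ≤ ENNReal.ofReal C) :
    ∃ ν : Measure H, IsFiniteMeasure ν ∧ NeZero ν ∧ ∀ k, ∀ A ∈ 𝒰 k, ∃ p ∈ A,
      ∀ S : Set H, p ∈ S → Metric.ediam A ^ t ≤ ν S := by
  have hne : ∀ i : (Σ k, 𝒰 k), (i.2 : Set H).Nonempty := by
    intro i
    rw [nonempty_iff_ne_empty]
    intro h
    simpa [h] using (hdiam i.1 i.2 i.2.2).1
  choose p hp using hne
  set μ : Measure H := Measure.sum fun i : (Σ k, 𝒰 k) =>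
    Metric.ediam (i.2 : Set H) ^ t • Measure.dirac (p i) with hμ
  have hfin : μ univ < ⊤ := by
    have hr : (2⁻¹ : ℝ≥0∞) ^ (t - s) < 1 :=
      ENNReal.rpow_lt_one (by simp) (by linarith)
    calc μ univ = ∑' k, ∑' A : 𝒰 k, Metric.ediam (A : Set H) ^ t := by
          rw [hμ, Measure.sum_apply _ MeasurableSet.univ, ENNReal.tsum_sigma']
          simp
      -- The spare exponent `t - s` makes the masses of the successive covers decay geometrically.
      _ ≤ ∑' k : ℕ, ENNReal.ofReal C * (2⁻¹ ^ (t - s)) ^ k := by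
          refine ENNReal.tsum_le_tsum fun k => ?_
          calc ∑' A : 𝒰 k, Metric.ediam (A : Set H) ^ t
              ≤ ∑' A : 𝒰 k, Metric.ediam (A : Set H) ^ s * (2⁻¹ ^ (t - s)) ^ k := by
                refine ENNReal.tsum_le_tsum fun A => ?_
                have hA := hdiam k A A.2
                have hA' : Metric.ediam (A : Set H) ≠ ⊤ :=
                  ne_top_of_le_ne_top (by finiteness) hA.2
                calc Metric.ediam (A : Set H) ^ t
                    = Metric.ediam (A : Set H) ^ s * Metric.ediam (A : Set H) ^ (t - s) := by
                      rw [← ENNReal.rpow_add _ _ hA.1.ne' hA']; ring_nf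
                  _ ≤ Metric.ediam (A : Set H) ^ s * (2⁻¹ ^ k) ^ (t - s) := by
                      gcongr
                      exact hA.2
                  _ = _ := by
                      rw [← ENNReal.rpow_natCast, ← ENNReal.rpow_natCast, ← ENNReal.rpow_mul,
                        ← ENNReal.rpow_mul, mul_comm (k : ℝ)]
            _ ≤ _ := by
                rw [ENNReal.tsum_mul_right]
                gcongr
                exact hsum k
      _ = ENNReal.ofReal C * (1 - 2⁻¹ ^ (t - s))⁻¹ := by
          rw [ENNReal.tsum_mul_left, ENNReal.tsum_geometric]
      _ < ⊤ := by
          refine ENNReal.mul_lt_top (by simp) ?_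
          rw [ENNReal.inv_lt_top]
          exact tsub_pos_of_lt hr
  -- The extra point mass keeps the measure nonzero even if all covers are empty.
  refine ⟨Measure.dirac 0 + μ, ⟨?_⟩, ⟨?_⟩, fun k A hA => ⟨p ⟨k, A, hA⟩, hp ⟨k, A, hA⟩, ?_⟩⟩
  · rw [Measure.add_apply, ENNReal.add_lt_top]
    exact ⟨by simp, hfin⟩
  · intro h
    have := congrArg (fun m : Measure H => m univ) h
    simp at this
  · intro S hS
    have h1 : Metric.ediam A ^ t • Measure.dirac (p ⟨k, A, hA⟩) ≤ μ :=
      Measure.le_sum (fun i : (Σ k, 𝒰 k) =>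
        Metric.ediam (i.2 : Set H) ^ t • Measure.dirac (p i)) ⟨k, A, hA⟩
    calc Metric.ediam A ^ t ≤ (Metric.ediam A ^ t • Measure.dirac (p ⟨k, A, hA⟩)) S := by
          rw [Measure.smul_apply, Measure.dirac_apply_of_mem hS]
          simp
      _ ≤ μ S := h1 S
      _ ≤ _ := by rw [Measure.add_apply]; exact self_le_add_left _ _

variable [InnerProductSpace ℝ H] [FiniteDimensional ℝ H] [BorelSpace H]

/-- A set of quasi-Hausdorff dimension less than `1` has images of arbitrarily small box-counting
dimension under quasisymmetric homeomorphisms. -/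
theorem exists_isQuasisymmetric_diamCoveringNumber_le {E : Set H}
    (hdim : quasiHausdorffDim E < 1) {ε : ℝ} (hε : 0 < ε) :
    ∃ f : H ≃ₜ H, IsQuasisymmetric f ∧ ∃ C : ℝ, 0 < C ∧ ∀ r : ℝ, 0 < r →
      (diamCoveringNumber (f '' E) r : ℝ≥0∞) ≤ ENNReal.ofReal (C * (1 + r ^ (-ε))) := by
  obtain ⟨θ, hθdim, hθ⟩ := (((tendsto_intermediateDim E).eventually_lt_const hdim).and
    self_mem_nhdsWithin).exists
  have hθ : 0 < θ := hθ
  simp only [intermediateDim, iInf_lt_iff] at hθdim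
  obtain ⟨s, ⟨hs0, C, hC, δ₀, hδ₀, hcov⟩, hs1⟩ := hθdim
  have hs0 : (0 : ℝ) < s := hs0
  have hs1 : (s : ℝ) < 1 := by exact_mod_cast hs1
  set δ : ℝ := min (δ₀ / 2) 1 with hδ
  have hδpos : 0 < δ := lt_min (by linarith) one_pos
  set D : ℕ → ℝ := fun k => δ * 2⁻¹ ^ k with hD
  have hDpos : ∀ k, 0 < D k := fun k => by positivity
  have hpow1 : ∀ k : ℕ, (2⁻¹ : ℝ) ^ k ≤ 1 := fun k => pow_le_one₀ (by norm_num) (by norm_num)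
  have hDle : ∀ k, D k ≤ 2⁻¹ ^ k := fun k =>
    mul_le_of_le_one_left (by positivity) (min_le_right _ _)
  have hDlt : ∀ k, D k < δ₀ := fun k =>
    calc D k ≤ δ := mul_le_of_le_one_right hδpos.le (hpow1 k)
      _ ≤ δ₀ / 2 := min_le_left _ _
      _ < δ₀ := by linarith
  choose 𝒰 hE hdiam hsum using fun k => hcov (D k) (hDpos k) (hDlt k)
  have hlow : ∀ k, 0 < D k ^ (1 / θ) := fun k => Real.rpow_pos_of_pos (hDpos k) _
  have hcard : ∀ k, ((𝒰 k).encard : ℝ≥0∞) ≤ ENNReal.ofReal (C * D k ^ (-(s / θ))) := by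
    intro k
    refine (encard_le_of_tsum_ediam_le (hlow k) hs0 (fun A hA => (hdiam k A hA).1)
      (hsum k)).trans_eq ?_
    rw [← Real.rpow_mul (hDpos k).le]
    ring_nf
  -- `t` and `β` divide `(s, 1)` into thirds: `t > s` makes the measure finite, `β > t` makes the
  -- potential blow up, `β < 1` makes the map exist.
  set t : ℝ := s + (1 - s) / 3 with ht
  set β : ℝ := s + 2 * (1 - s) / 3 with hβ
  have hβ0 : 0 < β := by rw [hβ]; linarith
  have hβ1 : β < 1 := by rw [hβ]; linarith
  have hβt : 0 < β - t := by rw [hβ, ht]; linarith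
  -- With `M * ε = s / θ`, a cover by `(D k) ^ (-s / θ)` sets of size `(D k) ^ M` has exponent `ε`.
  set M : ℝ := s / θ / ε with hM
  have hM0 : 0 < M := by positivity
  set N : ℝ := M / (β - t) with hN
  have hN0 : 0 < N := by positivity
  have hNM : (β - t) * N = M := by rw [hN]; field_simp
  have hdiam' : ∀ k, ∀ A ∈ 𝒰 k, 0 < Metric.ediam A ∧ Metric.ediam A ≤ 2⁻¹ ^ k := by
    intro k A hA
    refine ⟨(ENNReal.ofReal_pos.2 (hlow k)).trans_le (hdiam k A hA).1, (hdiam k A hA).2.trans ?_⟩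
    refine (ENNReal.ofReal_le_ofReal (hDle k)).trans_eq ?_
    rw [ENNReal.ofReal_pow (by norm_num), ENNReal.ofReal_inv_of_pos (by norm_num)]
    simp
  obtain ⟨ν, _, _, hν⟩ := exists_measure_ediam_rpow_le 𝒰 (t := t) (by rw [ht]; linarith) hdiam' hsum
  obtain ⟨f, hf, K, hK, hfK⟩ := exists_isQuasisymmetric_norm_sub_le ν hβ0 hβ1 hN0
  set L : ℝ := K * 2 ^ (β * N) + 1 with hL
  have hL0 : 0 < L := by positivity
  have himage : ∀ k, ∀ A ∈ 𝒰 k, Metric.ediam (f '' A) ≤ ENNReal.ofReal (L * D k ^ M) := by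
    intro k A hA
    obtain ⟨hA1, hA2⟩ := hdiam k A hA
    have hAtop : Metric.ediam A ≠ ⊤ := ne_top_of_le_ne_top ENNReal.ofReal_ne_top hA2
    set ρ := (Metric.ediam A).toReal with hρ
    have hρ0 : 0 < ρ := ENNReal.toReal_pos (hdiam' k A hA).1.ne' hAtop
    have hρD : ρ ≤ D k := ENNReal.toReal_le_of_le_ofReal (hDpos k).le hA2
    have hρ1 : ρ ≤ 1 := hρD.trans ((hDle k).trans (hpow1 k))
    have hdist : ∀ x ∈ A, ∀ y ∈ A, dist x y ≤ ρ := by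
      intro x hx y hy
      rw [hρ, dist_edist]
      exact ENNReal.toReal_mono hAtop (Metric.edist_le_ediam_of_mem hx hy)
    obtain ⟨p, hpA, hp⟩ := hν k A hA
    rw [Metric.ediam_image_le_iff]
    intro x hx y hy
    rw [edist_dist]
    refine ENNReal.ofReal_le_ofReal ?_
    rw [dist_eq_norm_sub']
    have hΦ : conformalFactor ν β N x ρ ≤ 2 ^ (β * N) * ρ ^ ((β - t) * N) := by
      refine conformalFactor_le_of_le_measure ν hβ0 hN0 hρ0 ?_
      rw [hρ, ENNReal.ofReal_toReal hAtop]
      exact hp _ (Metric.mem_closedBall.2 (hdist p hpA x hx))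
    rw [hNM] at hΦ
    have hxy : ‖y - x‖ ≤ ρ := by
      rw [← dist_eq_norm_sub']
      exact hdist x hx y hy
    calc ‖f y - f x‖ ≤ K * (‖y - x‖ * conformalFactor ν β N x ‖y - x‖) := hfK x y
      -- The factor `‖y - x‖` is only bounded by `1`; all the shrinking comes from the conformal
      -- factor.
      _ ≤ K * (1 * (2 ^ (β * N) * D k ^ M)) := by
          refine mul_le_mul_of_nonneg_left (mul_le_mul (hxy.trans hρ1) ?_ ENNReal.toReal_nonneg
            zero_le_one) hK
          refine (conformalFactor_mono ν hβ0 hN0 x hxy).trans (hΦ.trans ?_)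
          gcongr
      _ = K * 2 ^ (β * N) * D k ^ M := by ring
      _ ≤ L * D k ^ M := by
          have : 0 ≤ D k ^ M := Real.rpow_nonneg (hDpos k).le _
          refine mul_le_mul_of_nonneg_right ?_ this
          rw [hL]; linarith
  have hcount : ∀ k r, L * D k ^ M ≤ r →
      (diamCoveringNumber (f '' E) r : ℝ≥0∞) ≤ ENNReal.ofReal (C * D k ^ (-(s / θ))) := by
    intro k r hr
    refine le_trans ?_ (hcard k)
    exact ENat.toENNReal_le.2 (diamCoveringNumber_image_le (hE k) fun A hA =>
      (himage k A hA).trans (ENNReal.ofReal_le_ofReal hr))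
  have hMε : M * ε = s / θ := by rw [hM]; field_simp
  have hD0 : 0 < D 0 ^ (-(s / θ)) := Real.rpow_pos_of_pos (hDpos 0) _
  refine ⟨f, hf, C * (D 0 ^ (-(s / θ)) + 2 ^ (s / θ) * L ^ ε), by positivity, fun r hr => ?_⟩
  have hex : ∃ k, L * D k ^ M ≤ r := by
    have h1 : Tendsto D atTop (𝓝 0) := by
      simpa [hD] using (tendsto_pow_atTop_nhds_zero_of_lt_one (by norm_num) (by norm_num :
        (2⁻¹ : ℝ) < 1)).const_mul δ
    have h2 : Tendsto (fun k => L * D k ^ M) atTop (𝓝 0) := by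
      have := (h1.rpow_const (p := M) (Or.inr hM0.le)).const_mul L
      simpa [hM0.ne'] using this
    obtain ⟨k, hk⟩ := (h2.eventually_lt_const hr).exists
    exact ⟨k, hk.le⟩
  have hrε : 0 < r ^ (-ε) := by positivity
  have hLε : 0 < L ^ ε := by positivity
  have h2s : (0 : ℝ) < 2 ^ (s / θ) := by positivity
  refine (hcount _ r (Nat.find_spec hex)).trans (ENNReal.ofReal_le_ofReal ?_)
  rw [mul_assoc]
  refine mul_le_mul_of_nonneg_left ?_ hC.le
  -- If the first admissible scale is `D 0`, the summand `1` in `1 + r ^ (-ε)` suffices. Otherwise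
  -- the scale before it is too coarse, which bounds `D j` below by a power of `r`, and halving
  -- costs `2 ^ (s / θ)`.
  rcases hk : Nat.find hex with _ | j
  · nlinarith [mul_pos hD0 hrε, mul_pos h2s hLε, mul_pos (mul_pos h2s hLε) hrε]
  · have hj : r < L * D j ^ M := by
      have := Nat.find_min hex (m := j) (by omega)
      push Not at this
      exact this
    have hDj : D (j + 1) = D j * 2⁻¹ := by simp only [hD, pow_succ]; ring
    have h1 : D j ^ (-(s / θ)) ≤ L ^ ε * r ^ (-ε) := by
      have h2 : r / L ≤ D j ^ M := by rw [div_le_iff₀ hL0]; linarith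
      calc D j ^ (-(s / θ)) = (D j ^ M) ^ (-ε) := by
            rw [← Real.rpow_mul (hDpos j).le, mul_neg, hMε]
        _ ≤ (r / L) ^ (-ε) := Real.rpow_le_rpow_of_nonpos (by positivity) h2 (by linarith)
        _ = L ^ ε * r ^ (-ε) := by
            rw [Real.div_rpow hr.le hL0.le, Real.rpow_neg hL0.le, div_inv_eq_mul, mul_comm]
    have h3 : D (j + 1) ^ (-(s / θ)) = D j ^ (-(s / θ)) * 2 ^ (s / θ) := by
      rw [hDj, Real.mul_rpow (hDpos j).le (by norm_num), Real.inv_rpow (by norm_num),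
        Real.rpow_neg (by norm_num : (0 : ℝ) ≤ 2), inv_inv]
    rw [h3]
    nlinarith [mul_pos hD0 hrε, mul_pos h2s hLε, mul_le_mul_of_nonneg_right h1 h2s.le]

end Covers

/-! ### Consequences for the dimensions -/

/-- Two points of one sphere about `x` can be compared with `t = 1`, so the dilatation is at most `η
1` at every radius. -/
theorem IsQuasisymmetric.isQuasiconformal {n : ℕ}
    {f : EuclideanSpace ℝ (Fin n) ≃ₜ EuclideanSpace ℝ (Fin n)} (hf : IsQuasisymmetric f) :
    IsQuasiconformal f := by
  refine ⟨?_, fun _ => hf⟩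
  obtain ⟨η, hη⟩ := hf
  refine ⟨η 1, fun x => limsup_le_of_le (h := Eventually.of_forall fun r => ?_)⟩
  refine ENNReal.div_le_of_le_mul (iSup₂_le fun y hy => ?_)
  simp only [ENNReal.mul_iInf_of_ne (ENNReal.coe_ne_zero.2 (ne_of_gt
    (lt_of_le_of_lt zero_le (η.strictMono zero_lt_one)))) ENNReal.coe_ne_top]
  refine le_iInf₂ fun z hz => ?_
  rw [edist_nndist, edist_nndist, ← ENNReal.coe_mul, ENNReal.coe_le_coe]
  refine hη x y z 1 one_pos ?_
  rw [one_mul, ← NNReal.coe_le_coe, coe_nndist, coe_nndist, dist_comm x, dist_comm x,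
    Metric.mem_sphere.1 hy, Metric.mem_sphere.1 hz]

theorem IsQuasisymmetric.image {X Y : Type*} [MetricSpace X] [MetricSpace Y] {f : X ≃ₜ Y}
    (hf : IsQuasisymmetric f) (E : Set X) : IsQuasisymmetric (f.image E) := by
  obtain ⟨η, hη⟩ := hf
  exact ⟨η, fun x y z t ht h => hη x y z t ht h⟩

/-- From `r ≤ R ^ (1 / θ)` follows `R / r ≥ r ^ (-(1 - θ))`, so a cover of all of `F` at scale `r`
is already good enough for each ball. The summand `1` costs a factor `2`, since `r < 1`. -/
theorem assouadSpectrum_le_of_diamCoveringNumber_le {X : Type*} [MetricSpace X] {F : Set X}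
    {θ : ℝ} (hθ0 : 0 < θ) (hθ1 : θ < 1) {s : ℝ≥0} (hs : 0 < s) {C : ℝ} (hC : 0 < C)
    (hF : ∀ r : ℝ, 0 < r → (diamCoveringNumber F r : ℝ≥0∞) ≤
      ENNReal.ofReal (C * (1 + r ^ (-((1 - θ) * s))))) :
    assouadSpectrum θ F ≤ s := by
  refine iInf₂_le s ⟨hs, C * 2, by positivity, fun x _ r R hr hR hrR hRR hR1 => ?_⟩
  refine (ENat.toENNReal_le.2 (diamCoveringNumber_mono inter_subset_right r)).trans
    ((hF r hr).trans (ENNReal.ofReal_le_ofReal ?_))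
  have hr1 : r < 1 := hrR.trans_lt (hRR.trans hR1)
  have hsr : (0 : ℝ) < s := hs
  have h1 : 1 ≤ r ^ (-((1 - θ) * s)) :=
    Real.one_le_rpow_of_pos_of_le_one_of_nonpos hr hr1.le
      (neg_nonpos.2 (mul_nonneg (by linarith) hsr.le))
  have h2 : r ^ (-((1 - θ) * s)) ≤ (R / r) ^ (s : ℝ) := by
    have h3 : r ^ θ ≤ R := by
      calc r ^ θ ≤ (R ^ (1 / θ)) ^ θ := Real.rpow_le_rpow hr.le hrR hθ0.le
        _ = R := by rw [← Real.rpow_mul hR.le, one_div_mul_cancel hθ0.ne', Real.rpow_one]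
    have h4 : r ^ (θ - 1) ≤ R / r := by
      rw [Real.rpow_sub_one hr.ne']
      gcongr
    calc r ^ (-((1 - θ) * s)) = (r ^ (θ - 1)) ^ (s : ℝ) := by
          rw [← Real.rpow_mul hr.le]; ring_nf
      _ ≤ _ := Real.rpow_le_rpow (by positivity) h4 hsr.le
  rw [mul_assoc]
  gcongr
  linarith

/-- Only `r < diam F` matters, and there the summand `1` is at most `d ^ s * r ^ (-s)`. -/
theorem boxDim_le_of_diamCoveringNumber_le {X : Type*} [MetricSpace X] {F : Set X}
    (hbdd : Bornology.IsBounded F) {s : ℝ≥0} (hs : 0 < s) {C : ℝ} (hC : 0 < C)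
    (hF : ∀ r : ℝ, 0 < r → (diamCoveringNumber F r : ℝ≥0∞) ≤
      ENNReal.ofReal (C * (1 + r ^ (-(s : ℝ))))) :
    boxDim F ≤ s := by
  have hsr : (0 : ℝ) < s := hs
  set d : ℝ := Metric.diam F + 1
  have hd : 0 < d := by have := Metric.diam_nonneg (s := F); positivity
  refine iInf₂_le s ⟨hs, C * (d ^ (s : ℝ) + 1), by positivity, fun r hr hrF => ?_⟩
  refine (hF r hr).trans (ENNReal.ofReal_le_ofReal ?_)
  have hrd : r ≤ d := by
    have h1 : r ≤ Metric.diam F := by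
      rw [Metric.diam]
      exact (ENNReal.ofReal_le_iff_le_toReal hbdd.ediam_ne_top).1 hrF.le
    linarith
  have h1 : 1 ≤ d ^ (s : ℝ) * r ^ (-(s : ℝ)) := by
    rw [Real.rpow_neg hr.le, ← div_eq_mul_inv, one_le_div (by positivity)]
    gcongr
  rw [mul_assoc]
  gcongr
  linarith

theorem ENNReal.eq_zero_of_forall_le_coe {a : ℝ≥0∞} (h : ∀ s : ℝ≥0, 0 < s → a ≤ s) : a = 0 := by
  refine le_antisymm (ENNReal.le_of_forall_pos_le_add fun s hs _ => ?_) zero_le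
  rw [zero_add]
  exact h s hs

theorem mainTheorem5 (n : ℕ) (E : Set (EuclideanSpace ℝ (Fin n)))
    (hE : Bornology.IsBounded E) (hdim : quasiHausdorffDim E < 1) :
    (∀ θ : ℝ, 0 < θ → θ < 1 →
      (⨅ (f : EuclideanSpace ℝ (Fin n) ≃ₜ EuclideanSpace ℝ (Fin n)) (_ : IsQuasiconformal f),
        assouadSpectrum θ (f '' E)) = (0 : ℝ≥0∞)) ∧
    conformalBoxDim E = 0 := by
  refine ⟨fun θ hθ0 hθ1 => ENNReal.eq_zero_of_forall_le_coe fun s hs => ?_,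
    ENNReal.eq_zero_of_forall_le_coe fun s hs => ?_⟩
  · have hsr : (0 : ℝ) < s := hs
    obtain ⟨f, hf, C, hC, hcov⟩ := exists_isQuasisymmetric_diamCoveringNumber_le hdim
      (mul_pos (sub_pos.2 hθ1) hsr)
    exact (iInf₂_le f hf.isQuasiconformal).trans
      (assouadSpectrum_le_of_diamCoveringNumber_le hθ0 hθ1 hs hC hcov)
  · have hsr : (0 : ℝ) < s := hs
    obtain ⟨f, hf, C, hC, hcov⟩ := exists_isQuasisymmetric_diamCoveringNumber_le hdim hsr
    -- A homeomorphism need not preserve boundedness in general, but the closure of `E` is compact.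
    have hbdd : Bornology.IsBounded (f '' E) :=
      (hE.isCompact_closure.image f.continuous).isBounded.subset (image_mono subset_closure)
    have hbdd' : Bornology.IsBounded (univ : Set (f '' E)) := by
      rw [Bornology.isBounded_univ]
      exact boundedSpace_val_set_iff.2 hbdd
    have hle : conformalBoxDim E ≤ boxDim (univ : Set (f '' E)) :=
      iInf_le_of_le (f '' E : Set _) <| iInf_le_of_le Subtype.metricSpace <|
        iInf₂_le (f.image E) (hf.image E)
    refine hle.trans ?_
    exact boxDim_le_of_diamCoveringNumber_le hbdd' hs hC fun r hr =>
      (ENat.toENNReal_le.2 (diamCoveringNumber_univ_coe_le _ r)).trans (hcov r hr)
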